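/- **Setting.** Let $R$ be a principal ideal domain with field of fractions $K$ and let $d\ge 2$. A *model* over $K$ is a pair $[f,g]$ with $f=\sum_{i\le d} f_iz^i$, $g=\sum_{i\le d} g_iz^i$ in $K[z]$, viewed as dehomogenised binary forms $F,G$ of degree $d$, whose degree-$d$ resultant $\mathrm{Res}_d(F,G)$ is nonzero. For $\lambda\in K^\times$ and $A=\begin{pmatrix}\alpha&\beta\\ \gamma&\delta\end{pmatrix}\in \mathrm{GL}_2(K)$ put $[F,G]^{(\lambda,A)}=[\lambda F_A,\lambda G_A]$, where $$F_A=\delta F(\alpha X+\beta Y,\gamma X+\delta Y)-\beta G(\alpha X+\beta Y,\gamma X+\delta Y),$$ $$G_A=-\gamma F(\alpha X+\beta Y,\gamma X+\delta Y)+\alpha G(\alpha X+\beta Y,\gamma X+\delta Y).$$ For $\phi=f/g$, the models of the class $[\phi]$ are the $[f,g]^{(\lambda,A)}$. Let $\mathrm{Res}_R([\phi])$ be the $R$-ideal generated by the resultants $\mathrm{Res}_d$ of all models of $[\phi]$ with coefficients in $R$. A model of $[\phi]$ with coefficients in $R$ is *$R$-minimal* if its resultant generates $\mathrm{Res}_R([\phi])$.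 For a nonzero prime $\mathfrak p$ of $R$ choose a generator $\pi$ of $\mathfrak p$ and a set of representatives in $R$ of the residue field $k_{\mathfrak p}$. Let $v$ be the $\mathfrak p$-adic valuation on $K$; $v$ of a polynomial is the minimum of $v$ over its coefficients. **InequalitySolutions$(V)$**, for a finite family $V$ of pairs $(h,c)$, $h\in R_{\mathfrak p}[z]$, $c\in\mathbb R$. (1) Let $V'$ consist of $(\pi^{-v(h)}h,\,c-v(h))$ for the $(h,c)\in V$ with $h\ne0$, $c\ge v(h)$. (2) If $V'=\emptyset$, return $0$. (3) Let $\bar g\in k_{\mathfrak p}[z]$ be the gcd of the reductions of the polynomials in $V'$. (4) For each root of $\bar g$ in $k_{\mathfrak p}$, with representative $\beta_0\in R$, compute $\beta_1=\mathsf{InequalitySolutions}(\{(\pi^{-1}h'(\beta_0+\pi z),c'-1):(h',c')\in V'\})$; if $\beta_1\neq\mathsf{none}$, return $\beta_0+\pi\beta_1$. (5) If no root yields a solution, return $\mathsf{none}$. **LocalMinimalModel$(f,g)$** at $\mathfrak p$. Start with $(e_{1,\rm tot},e_{2,\rm tot},\beta_{\rm tot})=(0,0,0)$. 1. Put $e_1=-\min(v(f),v(g))$,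 replace $(f,g)$ by $(\pi^{e_1}f,\pi^{e_1}g)$, and add $e_1$ to $e_{1,\rm tot}$. 2. For each integer $e_2$ satisfying, with $d_G=\deg g$, $e_2>-\frac{2}{2d_G-d+1}v(g_{d_G})$ if $d_G>\frac{d+1}2$, $e_2>-\frac2{d-1}v(f_d)$ if $d_G<d$, and $e_2<\frac2{d-1}v(\mathrm{res}(f-zg,g))$ (the univariate resultant): - Let $V'$ be the conditions $v(f'_j(\beta))>\frac{d+1}2e_2$, $v(g'_j(\beta))>\frac{d+1}2e_2$ for $0\le j\le d$, where $$f'_j=\pi^{je_2}\sum_{i=j}^d\binom ij(f_i\beta^{i-j}-g_i\beta^{i-j+1}),\qquad g'_j=\pi^{(j+1)e_2}\sum_{i=j}^d\binom ijg_i\beta^{i-j};$$ clear denominators, i.e. replace $(h,c)$ by $(\pi^mh,c+m)$ with the least integer $m\ge0$ making the polynomial $\mathfrak p$-integral. - For $(h,c)\in V'$ with $n=\deg h\ge1$ and $h=\sum h_iz^i$ let $b(h,c)=\min\bigl(\frac{c-v(h_n)}n,\min_{i<n}\frac{v(h_i)-v(h_n)}{n-i}\bigr)$, and put $B=-\lceil\max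 b(h,c)\rceil$. Let $V$ consist of the pairs $(\pi^{\deg(h)B}h(\pi^{-B}z),\,c+\deg(h)B)$ if $B>0$, and $(h(\pi^{-B}z),c)$ if $B\le0$. - Let $\beta'=\mathsf{InequalitySolutions}(V)$. If $\beta'\ne\mathsf{none}$, put $\beta=\pi^{-B}\beta'$, replace $f$ by $f(\pi^{e_2}z+\beta)-\beta g(\pi^{e_2}z+\beta)$ and $g$ by $\pi^{e_2}g(\pi^{e_2}z+\beta)$ (both right-hand sides with the old $f,g$), add $\pi^{e_{2,\rm tot}}\beta$ to $\beta_{\rm tot}$, then add $e_2$ to $e_{2,\rm tot}$, and go back to 1. 3. If no $e_2$ succeeds, return $(e_{1,\rm tot},e_{2,\rm tot},\beta_{\rm tot})$ and $(f,g)$. **MinimalModel$(f,g)$**, for $f,g\in R[z]$ with $\max(\deg f,\deg g)=d$ and $\mathrm{Res}_d(f,g)\ne0$. Start with $(\lambda,\alpha,\beta)=(1,1,0)$. For each prime $\mathfrak p$ whose exponent in the factorization of the ideal $\mathrm{Res}_d(f,g)R$ of the input is at least $d\gcd(2,d+1)$, run $\mathsf{LocalMinimalModel}$ at $\mathfrak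 p$ on the current $(f,g)$, giving $(e_1,e_2,b)$ and a new $(f,g)$; then replace $\lambda$ by $\lambda\pi^{e_1}$, $\beta$ by $\beta+\alpha b$ and afterwards $\alpha$ by $\alpha\pi^{e_2}$. Return $(\lambda,\alpha,\beta)$ and $(f,g)$. **Theorem.** Let $f_{\rm in},g_{\rm in}\in R[z]$ with $\max(\deg f_{\rm in},\deg g_{\rm in})=d\geq 2$ and $\mathrm{Res}_d(f_{\rm in},g_{\rm in})\neq0$, and let $\phi=f_{\rm in}/g_{\rm in}$. For every choice of the generators $\pi$ of the primes, of the representatives in $R$ of the residue fields, and of the orders in which the finite loops are traversed, $\mathsf{MinimalModel}(f_{\rm in},g_{\rm in})$ terminates. It returns $\lambda,\alpha\in K^\times$, $\beta\in K$ and a model $[f,g]$ with coefficients in $R$ such that $$[f,g]=[f_{\rm in},g_{\rm in}]^{\left(\lambda,\begin{pmatrix}\alpha&\beta\\0&1\end{pmatrix}\right)}$$ and $[f,g]$ is an $R$-minimal model of $[\phi]$. If $[f_{\rm in},g_{\rm in}]$ is already $R$-minimal, then $[f,g]=[f_{\rm in},g_{\rm in}]$ and $(\lambda,\alpha,\beta)=(1,1,0)$.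 -/

import Mathlib

open Polynomial IsDedekindDomain

/-! ## Models of rational maps, the action of `𝔾ₘ × GL₂`, resultants and minimality

A model `[F, G]` of degree `d` (two binary forms of degree `d`) is stored through its
dehomogenisation `(f, g) = (F(z, 1), G(z, 1))`, a pair of polynomials of degree at most `d`. -/

section Models

variable {K : Type*} [Field K]

/-- The resultant of `F` and `G` as binary forms of degree `d`. -/
noncomputable def modelRes (d : ℕ) (P : K[X] × K[X]) : K :=
  resultant P.1 P.2 d d

/-- `[F, G]` belongs to `M_d(K)`: two forms of degree `d` whose resultant does not vanish. -/
def IsModel (d : ℕ) (P : K[X] × K[X]) : Prop :=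
  P.1.natDegree ≤ d ∧ P.2.natDegree ≤ d ∧ modelRes d P ≠ 0

/-- The dehomogenisation of `F(α X + β Y, γ X + δ Y)`, for a form `F = ∑ fᵢ Xⁱ Y^(d-i)` and
`A = (α, β; γ, δ)`. -/
noncomputable def substForm (d : ℕ) (A : Matrix (Fin 2) (Fin 2) K) (f : K[X]) : K[X] :=
  ∑ i ∈ Finset.range (d + 1),
    C (f.coeff i) * (C (A 0 0) * X + C (A 0 1)) ^ i * (C (A 1 0) * X + C (A 1 1)) ^ (d - i)

/-- `[F, G]^(l, A) = [l F_A, l G_A]`, where `[F_A, G_A] = A^adj ∘ [F, G] ∘ A`. -/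
noncomputable def actModel (d : ℕ) (l : K) (A : Matrix (Fin 2) (Fin 2) K)
    (P : K[X] × K[X]) : K[X] × K[X] :=
  (C l * (C (A 1 1) * substForm d A P.1 - C (A 0 1) * substForm d A P.2),
   C l * (-C (A 1 0) * substForm d A P.1 + C (A 0 0) * substForm d A P.2))

/-- `Q` is a model of the `PGL₂(K)`-conjugacy class of the rational map given by `P`. -/
def SameClass (d : ℕ) (P Q : K[X] × K[X]) : Prop :=
  ∃ (l : Kˣ) (A : GL (Fin 2) K), Q = actModel d (l : K) (A : Matrix (Fin 2) (Fin 2) K) P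

variable (R : Type*) [CommRing R] [Algebra R K]

/-- The model has coefficients in `R`. -/
def IsOver (P : K[X] × K[X]) : Prop :=
  P.1 ∈ lifts (algebraMap R K) ∧ P.2 ∈ lifts (algebraMap R K)

/-- The ideal `Res_R([φ])` generated by the resultants of all models over `R` of the conjugacy
class `[φ]` of the map `φ` given by `P`. -/
def resIdeal (d : ℕ) (P : K[X] × K[X]) : Ideal R :=
  Ideal.span {r : R | ∃ Q : K[X] × K[X],
    IsModel d Q ∧ IsOver R Q ∧ SameClass d P Q ∧ algebraMap R K r = modelRes d Q}

/-- `Q` is an `R`-minimal model of the conjugacy class of the map given by `P`. -/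
def IsMinimalModelOf (d : ℕ) (P Q : K[X] × K[X]) : Prop :=
  IsModel d Q ∧ IsOver R Q ∧ SameClass d P Q ∧
    ∃ r : R, algebraMap R K r = modelRes d Q ∧ resIdeal R d P = Ideal.span {r}

end Models

/-! ## Valuations and reduction at a prime -/

section Local

variable {R : Type*} [CommRing R] [IsDedekindDomain R]
variable {K : Type*} [Field K] [Algebra R K] [IsFractionRing R K]

open Classical in
/-- The additive valuation `v : K → ℤ ∪ {∞}` at `𝔭`. -/
noncomputable def ordAt (p : HeightOneSpectrum R) (x : K) : WithTop ℤ :=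
  if x = 0 then ⊤ else ((-WithZero.log (p.valuation K x) : ℤ) : WithTop ℤ)

/-- The valuation of a nonzero element as an integer (`0` at `0`). -/
noncomputable def ordInt (p : HeightOneSpectrum R) (x : K) : ℤ := (ordAt p x).untopD 0

/-- `v(h)`, the least valuation of a coefficient of `h` (`∞` for `h = 0`). -/
noncomputable def polyOrd (p : HeightOneSpectrum R) (h : K[X]) : WithTop ℤ :=
  h.support.inf fun i => ordAt p (h.coeff i)

/-- `v(h)` of a nonzero polynomial as an integer (`0` at `0`). -/
noncomputable def polyOrdInt (p : HeightOneSpectrum R) (h : K[X]) : ℤ := (polyOrd p h).untopD 0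

variable (K) in
/-- The residue field `k_𝔭` of the localization `R_𝔭 ⊆ K`. -/
abbrev ResidueAt (p : HeightOneSpectrum R) : Type _ :=
  IsLocalRing.ResidueField (HeightOneSpectrum.valuationSubringAtPrime K p)

open Classical in
/-- Reduction `R_𝔭 → k_𝔭`, extended by `0` to `K`; it is only used on `R_𝔭`. -/
noncomputable def redAt (p : HeightOneSpectrum R) (x : K) : ResidueAt K p :=
  if hx : x ∈ HeightOneSpectrum.valuationSubringAtPrime K p then
    IsLocalRing.residue (HeightOneSpectrum.valuationSubringAtPrime K p) ⟨x, hx⟩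
  else 0

/-- Coefficientwise reduction of a polynomial with coefficients in `R_𝔭`. -/
noncomputable def redPoly (p : HeightOneSpectrum R) (h : K[X]) : (ResidueAt K p)[X] :=
  ∑ i ∈ h.support, monomial i (redAt p (h.coeff i))

variable (R K) in
/-- Everything that the procedures leave open: a generator of each prime ideal,
representatives in `R` of the residue field of each prime, and the orders in which the
finite sets of the `for`-loops are traversed. -/
structure Choices where
  gen : HeightOneSpectrum R → R
  span_gen : ∀ p, Ideal.span {gen p} = p.asIdeal
  rep : ∀ p : HeightOneSpectrum R, ResidueAt K p → R
  red_rep : ∀ p x, redAt p (algebraMap R K (rep p x)) = x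
  rootOrder : ∀ p : HeightOneSpectrum R, Finset (ResidueAt K p) → List (ResidueAt K p)
  rootOrder_spec : ∀ p S, (rootOrder p S).Nodup ∧ ∀ x, x ∈ rootOrder p S ↔ x ∈ S
  intOrder : Finset ℤ → List ℤ
  intOrder_spec : ∀ S, (intOrder S).Nodup ∧ ∀ x, x ∈ intOrder S ↔ x ∈ S
  primeOrder : Finset (HeightOneSpectrum R) → List (HeightOneSpectrum R)
  primeOrder_spec : ∀ S, (primeOrder S).Nodup ∧ ∀ x, x ∈ primeOrder S ↔ x ∈ S

/-- Over a principal ideal domain the choices can be made. -/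
theorem Choices.nonempty [IsPrincipalIdealRing R] : Nonempty (Choices R K) := by
  have hg : ∀ p : HeightOneSpectrum R, ∃ r : R, Ideal.span {r} = p.asIdeal := fun p =>
    ⟨Submodule.IsPrincipal.generator p.asIdeal, Ideal.span_singleton_generator _⟩
  have hr : ∀ (p : HeightOneSpectrum R) (x : ResidueAt K p),
      ∃ r : R, redAt p (algebraMap R K r) = x := by
    intro p x
    obtain ⟨⟨a, ha⟩, rfl⟩ := IsLocalRing.residue_surjective x
    have ha' : p.valuation K a ≤ 1 := HeightOneSpectrum.valuationSubringAtPrime_le_valuation p ha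
    obtain ⟨r, hr⟩ := HeightOneSpectrum.exists_valuation_sub_lt_of_integer (γ := 1) p ha'
    refine ⟨r, ?_⟩
    have hm : algebraMap R K r ∈ HeightOneSpectrum.valuationSubringAtPrime K p := by
      rw [HeightOneSpectrum.valuationSubringAtPrime_eq_valuationSubring]
      exact p.valuation_le_one r
    rw [redAt, dif_pos hm, ← sub_eq_zero, ← map_sub, IsLocalRing.residue_eq_zero_iff,
      IsLocalRing.mem_maximalIdeal, mem_nonunits_iff]
    intro hu
    obtain ⟨⟨⟨u, hu1⟩, ⟨w, hw1⟩, huw, _⟩, hu'⟩ := hu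
    have e1 : u = algebraMap R K r - a := congrArg Subtype.val hu'
    have e2 : u * w = 1 := congrArg Subtype.val huw
    have hw' : p.valuation K w ≤ 1 :=
      HeightOneSpectrum.valuationSubringAtPrime_le_valuation p hw1
    have h3 : p.valuation K u * p.valuation K w = 1 := by rw [← map_mul, e2, map_one]
    rw [e1] at h3
    have h4 : p.valuation K (algebraMap R K r - a) < 1 := by simpa using hr
    have := mul_lt_one_of_lt_of_le h4 hw'
    exact absurd h3 this.ne
  choose gen hgen using hg
  choose rep hrep using hr
  exact ⟨⟨gen, hgen, rep, hrep, fun _ S => S.toList, fun _ S => ⟨S.nodup_toList, by simp⟩,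
    fun S => S.toList, fun S => ⟨S.nodup_toList, by simp⟩,
    fun S => S.toList, fun S => ⟨S.nodup_toList, by simp⟩⟩⟩

/-! ## The procedures

Every procedure carries a bound on the depth of its recursion. The outer
`Option` is `none` exactly when the computation was cut off by that bound; so a procedure
terminates with value `x` if it evaluates to `some x` for all large bounds. -/

/-- `for a in l: if body(a) ≠ none then return body(a)`, and `none` if the loop runs through.
The loop stops without an answer as soon as one call of the body does. -/
def firstSuccess {α γ : Type*} (body : α → Option (Option γ)) : List α → Option (Option γ)
  | [] => some none
  | a :: l =>
    match body a with
    | none => none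
    | some none => firstSuccess body l
    | some (some c) => some (some c)

open Classical in
/-- Drop the vacuous conditions `v(h(z)) > c` (those with `h = 0` or `c < v(h)`) and divide the
others by `π^v(h)`. -/
noncomputable def normalizeConds (p : HeightOneSpectrum R) (π : R) (V : List (K[X] × ℝ)) :
    List (K[X] × ℝ) :=
  (V.filter fun q => decide (q.1 ≠ 0 ∧ (polyOrdInt p q.1 : ℝ) ≤ q.2)).map fun q =>
    (C ((algebraMap R K π) ^ (-polyOrdInt p q.1)) * q.1, q.2 - polyOrdInt p q.1)

/-- `V'' = {(π⁻¹ h(β₀ + π z), c - 1)}`. -/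
noncomputable def shiftConds (π β₀ : R) (V : List (K[X] × ℝ)) : List (K[X] × ℝ) :=
  V.map fun q =>
    (C ((algebraMap R K π)⁻¹) * q.1.comp (C (algebraMap R K β₀) + C (algebraMap R K π) * X),
      q.2 - 1)

open Classical in
/-- `InequalitySolutions(V)`: search for `β ∈ R` with `v(h(β)) > c` for all `(h, c) ∈ V`. The
inner `Option` is the answer, `none` meaning that there is no solution. -/
noncomputable def inequalitySolutions (ch : Choices R K) (p : HeightOneSpectrum R) :
    ℕ → List (K[X] × ℝ) → Option (Option R)
  | 0, _ => none
  | n + 1, V =>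
    let V' := normalizeConds p (ch.gen p) V
    if V' = [] then some (some 0)
    else
      let gbar : (ResidueAt K p)[X] :=
        (V'.map fun q => redPoly p q.1).foldr (fun a b => EuclideanDomain.gcd a b) 0
      let W : List R := (ch.rootOrder p gbar.roots.toFinset).map (ch.rep p)
      firstSuccess (fun β₀ =>
        (inequalitySolutions ch p n (shiftConds (ch.gen p) β₀ V')).map fun o =>
          o.map fun β₁ => β₀ + ch.gen p * β₁) W

/-- `f'_j = π^(j e₂) ∑_{i ≥ j} binom(i, j) (fᵢ z^(i-j) - gᵢ z^(i-j+1))` as a polynomial in the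
translation parameter `z`. -/
noncomputable def fCoeffPoly (d : ℕ) (π : K) (e₂ : ℤ) (P : K[X] × K[X]) (j : ℕ) : K[X] :=
  C (π ^ ((j : ℤ) * e₂)) * ∑ i ∈ Finset.Icc j d,
    C ((i.choose j : ℕ) : K) *
      (C (P.1.coeff i) * X ^ (i - j) - C (P.2.coeff i) * X ^ (i - j + 1))

/-- `g'_j = π^((j+1) e₂) ∑_{i ≥ j} binom(i, j) gᵢ z^(i-j)`. -/
noncomputable def gCoeffPoly (d : ℕ) (π : K) (e₂ : ℤ) (P : K[X] × K[X]) (j : ℕ) : K[X] :=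
  C (π ^ (((j : ℤ) + 1) * e₂)) * ∑ i ∈ Finset.Icc j d,
    C ((i.choose j : ℕ) : K) * (C (P.2.coeff i) * X ^ (i - j))

/-- Replace `v(h(z)) > c` by `v(π^m h(z)) > c + m` with the least `m ≥ 0` that makes the
polynomial integral at `𝔭`. -/
noncomputable def clearDenoms (p : HeightOneSpectrum R) (π : R) (q : K[X] × ℝ) : K[X] × ℝ :=
  let m : ℤ := max 0 (-polyOrdInt p q.1)
  (C ((algebraMap R K π) ^ m) * q.1, q.2 + m)

/-- The conditions `v(f'_j) > (d+1)/2 · e₂` and `v(g'_j) > (d+1)/2 · e₂` for `0 ≤ j ≤ d` on the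
translation parameter, with denominators cleared. -/
noncomputable def reductionConds (d : ℕ) (p : HeightOneSpectrum R) (π : R) (e₂ : ℤ)
    (P : K[X] × K[X]) : List (K[X] × ℝ) :=
  (((List.range (d + 1)).map fun j =>
      (fCoeffPoly d (algebraMap R K π) e₂ P j, ((d : ℝ) + 1) / 2 * e₂)) ++
    ((List.range (d + 1)).map fun j =>
      (gCoeffPoly d (algebraMap R K π) e₂ P j, ((d : ℝ) + 1) / 2 * e₂))).map (clearDenoms p π)

/-- For `h` of degree `n ≥ 1`, the lower bound
`min ((c - v(hₙ))/n, min_{i < n} (v(hᵢ) - v(hₙ))/(n - i))` for `v(β)` when `v(h(β)) > c`; terms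
with `hᵢ = 0` are infinite and left out. -/
noncomputable def betaBound (p : HeightOneSpectrum R) (h : K[X]) (c : ℝ) : ℝ :=
  let n := h.natDegree
  let vn : ℝ := ordInt p (h.coeff n)
  (min ((((c - vn) / n : ℝ)) : WithTop ℝ)
    ((h.support.erase n).inf fun i =>
      (((((ordInt p (h.coeff i) : ℝ) - vn) / ((n : ℝ) - i) : ℝ)) : WithTop ℝ))).untopD 0

open Classical in
/-- The integer `B` such that every solution `β ∈ K` of the conditions is of the form `π^(-B) β'`
with `β'` integral at `𝔭`: minus the largest of the bounds, rounded up. Constant polynomials give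
no bound. -/
noncomputable def denomExp (p : HeightOneSpectrum R) (V : List (K[X] × ℝ)) : ℤ :=
  -⌈(((V.filter fun q => decide (1 ≤ q.1.natDegree)).map fun q =>
      betaBound p q.1 q.2).maximum).unbotD 0⌉

/-- The conditions in the variable `β' = π^B β`, again with integral coefficients. -/
noncomputable def rescaleConds (π : R) (B : ℤ) (V : List (K[X] × ℝ)) : List (K[X] × ℝ) :=
  V.map fun q =>
    let h := q.1.comp (C ((algebraMap R K π) ^ (-B)) * X)
    if 0 < B then
      (C ((algebraMap R K π) ^ ((q.1.natDegree : ℤ) * B)) * h, q.2 + (q.1.natDegree : ℝ) * B)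
    else (h, q.2)

/-- The finite range of exponents `e₂`: with `d_G = deg g`,
* `e₂ > -2/(2 d_G - d + 1) · v(g_{d_G})` if `d_G > (d+1)/2`;
* `e₂ > -2/(d-1) · v(f_d)` if `d_G < d`;
* `e₂ < 2/(d-1) · v(res(f - z g, g))`. -/
noncomputable def e₂Range (d : ℕ) (p : HeightOneSpectrum R) (P : K[X] × K[X]) : Finset ℤ :=
  let dG := P.2.natDegree
  let L₁ : ℝ := -(2 / (2 * (dG : ℝ) - d + 1)) * ordInt p (P.2.coeff dG)
  let L₂ : ℝ := -(2 / ((d : ℝ) - 1)) * ordInt p (P.1.coeff d)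
  let L : ℝ := if dG < d then (if d + 1 < 2 * dG then max L₁ L₂ else L₂) else L₁
  let U : ℝ := 2 / ((d : ℝ) - 1) * ordInt p (resultant (P.1 - X * P.2) P.2)
  Finset.Ioo ⌊L⌋ ⌈U⌉

/-- The variables of `LocalMinimalModel`: the total transformation `(e₁, e₂, β)` and the current
model `(f, g)`. -/
structure LocalState (K : Type*) [Field K] where
  e₁ : ℤ
  e₂ : ℤ
  β : K
  model : K[X] × K[X]

/-- Scale the model by `π^e₁`, `e₁ = -min(v(f), v(g))`. -/
noncomputable def LocalState.scale (p : HeightOneSpectrum R) (π : R) (s : LocalState K) :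
    LocalState K :=
  let e : ℤ := -(min (polyOrd p s.model.1) (polyOrd p s.model.2)).untopD 0
  { s with
    e₁ := s.e₁ + e
    model := (C ((algebraMap R K π) ^ e) * s.model.1, C ((algebraMap R K π) ^ e) * s.model.2) }

/-- Replace `f, g` by `f(π^e₂ z + β) - β g(π^e₂ z + β)`, `π^e₂ g(π^e₂ z + β)` and compose the
transformations. -/
noncomputable def LocalState.move (π : R) (s : LocalState K) (e₂ : ℤ) (β : K) : LocalState K :=
  let a : K := (algebraMap R K π) ^ e₂
  let f := s.model.1.comp (C a * X + C β)
  let g := s.model.2.comp (C a * X + C β)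
  { e₁ := s.e₁
    e₂ := s.e₂ + e₂
    β := s.β + (algebraMap R K π) ^ s.e₂ * β
    model := (f - C β * g, C a * g) }

/-- For a given `e₂`, search for `β ∈ K` satisfying the reduction conditions. -/
noncomputable def findBeta (ch : Choices R K) (p : HeightOneSpectrum R) (n d : ℕ)
    (P : K[X] × K[X]) (e₂ : ℤ) : Option (Option (ℤ × K)) :=
  let V' := reductionConds d p (ch.gen p) e₂ P
  let B := denomExp p V'
  (inequalitySolutions ch p n (rescaleConds (ch.gen p) B V')).map fun o =>
    o.map fun β' => (e₂, (algebraMap R K (ch.gen p)) ^ (-B) * algebraMap R K β')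

/-- The loop of `LocalMinimalModel`, started in an arbitrary state. -/
noncomputable def localLoop (ch : Choices R K) (p : HeightOneSpectrum R) (d : ℕ) :
    ℕ → LocalState K → Option (LocalState K)
  | 0, _ => none
  | n + 1, s =>
    let s' := s.scale p (ch.gen p)
    match firstSuccess (findBeta ch p n d s'.model) (ch.intOrder (e₂Range d p s'.model)) with
    | none => none
    | some none => some s'
    | some (some (e₂, β)) => localLoop ch p d n (s'.move (ch.gen p) e₂ β)

/-- `LocalMinimalModel(f, g)` with respect to `R_𝔭`. -/
noncomputable def localMinimalModel (ch : Choices R K) (p : HeightOneSpectrum R) (n d : ℕ)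
    (P : K[X] × K[X]) : Option (LocalState K) :=
  localLoop ch p d n ⟨0, 0, 0, P⟩

/-- The variables of `MinimalModel`: the total transformation `(λ, (α, β; 0, 1))` and the current
model. -/
structure GlobalState (K : Type*) [Field K] where
  l : K
  α : K
  β : K
  model : K[X] × K[X]

open Classical in
/-- The primes `𝔭` whose exponent in the factorization of `r R` is at least `d · gcd(2, d + 1)`
(for `r ≠ 0` and `d ≥ 1` there are finitely many). -/
noncomputable def candidatePrimes (d : ℕ) (r : R) : Finset (HeightOneSpectrum R) :=
  let S : Set (HeightOneSpectrum R) :=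
    {p | ((d * Nat.gcd 2 (d + 1) : ℕ) : ℕ∞) ≤ emultiplicity p.asIdeal (Ideal.span {r})}
  if h : S.Finite then h.toFinset else ∅

/-- One pass of the loop of `MinimalModel`, for the prime `𝔭`. -/
noncomputable def globalStep (ch : Choices R K) (n d : ℕ) (s : GlobalState K)
    (p : HeightOneSpectrum R) : Option (GlobalState K) :=
  (localMinimalModel ch p n d s.model).map fun (t : LocalState K) =>
    { l := s.l * (algebraMap R K (ch.gen p)) ^ t.e₁
      α := s.α * (algebraMap R K (ch.gen p)) ^ t.e₂
      β := s.β + s.α * t.β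
      model := t.model }

/-- `MinimalModel(f, g)` for `f, g ∈ R[z]` with `max(deg f, deg g) = d`, where every recursion is
cut off at depth `n`. -/
noncomputable def minimalModel (ch : Choices R K) (n : ℕ) (f g : R[X]) : Option (GlobalState K) :=
  let d := max f.natDegree g.natDegree
  (ch.primeOrder (candidatePrimes d (resultant f g d d))).foldlM (globalStep ch n d)
    ⟨1, 1, 0, (f.map (algebraMap R K), g.map (algebraMap R K))⟩

end Local

/-! Write v for the valuation at a prime p. Acting by (λ, A) multiplies the resultant by λ^(2d) ·
det(A)^(d²+d) up to sign, so it shifts v(Res) by 2d·v(λ) + (d²+d)·v(det A) (`modelRes_actModel_sq`,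
`ordInt_modelRes_actModel`). Signs do not affect valuations, so the resultant formula is only needed
for squares.

Local step. By column operations over the local ring, every model of the class that is integral at p
can be replaced by one with λ = π^m and A = (π^e, β; 0, 1), with the same v(Res) and still integral
(`exists_affine_transformation`). Such a model has smaller v(Res) than the current one exactly when
2m + (d+1)e < 0, and integrality then says that all coefficients obtained from (π^e, β; 0, 1) alone
have valuation at least -m > (d+1)e/2. Hence the current model is minimal at p as soon as no pair
(e, β) satisfies this inequality (`isMinimalAt_of_forall`).

The search for (e, β) is finite. Leading coefficients bound e from below; the constant coefficients
make β an approximate common root of f - zg and g, which bounds e from above by a resultant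
(`mem_e₂Range`). For fixed e, domination by the leading term bounds the denominator of β
(`betaBound_le`), and the remaining search modulo powers of π is exact and ends because each
recursion lowers all thresholds by 1 (`inequalitySolutions_spec`). A success followed by scaling
strictly lowers the nonnegative integer v(Res), so the loop ends, and it ends at a minimal model
(`localLoop_spec`).

Globally, a step at p uses only powers of π and translations that are integral away from p, so it
preserves integrality and v_q(Res) at every q ≠ p. Primes that are never visited need no work:
v(Res) only changes by multiples of d·gcd(2, d+1), so a smaller value is already minimal
(`isMinimalAt_of_ordInt_lt`). Minimality at all primes is minimality over R. If the input is
minimal, no v_q(Res) can drop, so no step succeeds, every scaling is trivial, and the state is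
returned literally unchanged. -/

/-! ### Valuation bounds for elements and polynomials -/

section OrdGE

variable {R : Type*} [CommRing R] [IsDedekindDomain R]
variable {K : Type*} [Field K] [Algebra R K] [IsFractionRing R K]
variable {p : HeightOneSpectrum R} {k l : ℤ} {x y : K} {f g h : K[X]}

/-- `v(x) ≥ k`, including the case `x = 0`. -/
def OrdGE (p : HeightOneSpectrum R) (k : ℤ) (x : K) : Prop :=
  p.valuation K x ≤ WithZero.exp (-k)

lemma ordInt_of_ne_zero (hx : x ≠ 0) : ordInt p x = -WithZero.log (p.valuation K x) := by
  simp only [ordInt, ordAt, if_neg hx]; rfl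

lemma valuation_eq_exp (hx : x ≠ 0) : p.valuation K x = WithZero.exp (-ordInt p x) := by
  rw [ordInt_of_ne_zero hx, neg_neg, WithZero.exp_log]
  exact (Valuation.ne_zero_iff _).2 hx

/-- The hypothesis matters: `ordInt` has the default value 0 at 0, while `OrdGE p k 0` holds for
every k. Hence bounds are carried as `OrdGE` and become integer inequalities only for nonzero
elements. -/
lemma ordGE_iff (hx : x ≠ 0) : OrdGE p k x ↔ k ≤ ordInt p x := by
  rw [OrdGE, valuation_eq_exp hx, WithZero.exp_le_exp, neg_le_neg_iff]

@[simp] lemma ordGE_zero : OrdGE p k (0 : K) := by simp [OrdGE]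

@[simp] lemma ordInt_zero : ordInt p (0 : K) = 0 := by simp [ordInt, ordAt]

lemma ordInt_mul (hx : x ≠ 0) (hy : y ≠ 0) : ordInt p (x * y) = ordInt p x + ordInt p y := by
  have h := valuation_eq_exp (p := p) (mul_ne_zero hx hy)
  rw [map_mul, valuation_eq_exp hx, valuation_eq_exp hy, ← WithZero.exp_add,
    WithZero.exp_inj] at h
  linarith

@[simp] lemma ordInt_one : ordInt p (1 : K) = 0 := by
  rw [ordInt_of_ne_zero one_ne_zero]; simp

lemma ordInt_inv (hx : x ≠ 0) : ordInt p x⁻¹ = -ordInt p x := by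
  have h := ordInt_mul (p := p) hx (inv_ne_zero hx)
  rw [mul_inv_cancel₀ hx, ordInt_one] at h
  linarith

lemma ordInt_neg : ordInt p (-x) = ordInt p x := by
  by_cases hx : x = 0
  · simp [hx]
  · rw [ordInt_of_ne_zero hx, ordInt_of_ne_zero (neg_ne_zero.2 hx), Valuation.map_neg]

lemma ordInt_pow (hx : x ≠ 0) (n : ℕ) : ordInt p (x ^ n) = n * ordInt p x := by
  induction n with
  | zero => simp
  | succ n ih => rw [pow_succ, ordInt_mul (pow_ne_zero _ hx) hx, ih]; push_cast; ring

lemma ordInt_zpow (hx : x ≠ 0) (n : ℤ) : ordInt p (x ^ n) = n * ordInt p x := by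
  cases n with
  | ofNat n => simpa using ordInt_pow hx n
  | negSucc n =>
    rw [zpow_negSucc, ordInt_inv (pow_ne_zero _ hx), ordInt_pow hx, Int.negSucc_eq]
    push_cast; ring

lemma OrdGE.mono (h : OrdGE p k x) (hl : l ≤ k) : OrdGE p l x :=
  le_trans h (WithZero.exp_le_exp.2 (neg_le_neg hl))

lemma OrdGE.add (hx : OrdGE p k x) (hy : OrdGE p k y) : OrdGE p k (x + y) :=
  Valuation.map_add_le _ hx hy

lemma OrdGE.neg (hx : OrdGE p k x) : OrdGE p k (-x) := by
  rwa [OrdGE, Valuation.map_neg]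

lemma OrdGE.sub (hx : OrdGE p k x) (hy : OrdGE p k y) : OrdGE p k (x - y) := by
  rw [sub_eq_add_neg]; exact hx.add hy.neg

lemma OrdGE.mul (hx : OrdGE p k x) (hy : OrdGE p l y) : OrdGE p (k + l) (x * y) := by
  rw [OrdGE, map_mul, neg_add, WithZero.exp_add]
  exact mul_le_mul' hx hy

lemma OrdGE.mul_zero (hx : OrdGE p k x) (hy : OrdGE p 0 y) : OrdGE p k (x * y) := by
  simpa using hx.mul hy

lemma OrdGE.sum {ι : Type*} {s : Finset ι} {u : ι → K} (h : ∀ i ∈ s, OrdGE p k (u i)) :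
    OrdGE p k (∑ i ∈ s, u i) := by
  classical
  induction s using Finset.induction_on with
  | empty => simp
  | insert a s ha ih =>
    rw [Finset.sum_insert ha]
    exact (h _ (Finset.mem_insert_self _ _)).add
      (ih fun i hi => h i (Finset.mem_insert_of_mem hi))

@[simp] lemma ordGE_one : OrdGE p 0 (1 : K) := by simp [OrdGE]

lemma OrdGE.pow (hx : OrdGE p k x) (n : ℕ) : OrdGE p (n * k) (x ^ n) := by
  induction n with
  | zero => simp
  | succ n ih =>
    rw [pow_succ]
    have := ih.mul hx
    push_cast
    convert this using 1
    ring

lemma OrdGE.pow_zero (hx : OrdGE p 0 x) (n : ℕ) : OrdGE p 0 (x ^ n) := by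
  simpa using hx.pow n

lemma ordGE_algebraMap (r : R) : OrdGE p 0 (algebraMap R K r) := by
  simpa [OrdGE] using p.valuation_le_one r

lemma mem_valuationSubringAtPrime :
    x ∈ HeightOneSpectrum.valuationSubringAtPrime K p ↔ OrdGE p 0 x := by
  rw [HeightOneSpectrum.valuationSubringAtPrime_eq_valuationSubring, OrdGE]
  simp [Valuation.mem_valuationSubring_iff]

lemma ordGE_ordInt (x : K) : OrdGE p (ordInt p x) x := by
  by_cases hx : x = 0
  · simp [hx]
  · rw [ordGE_iff hx]

lemma OrdGE.ordInt_le (h : OrdGE p k x) (hx : x ≠ 0) : k ≤ ordInt p x := (ordGE_iff hx).1 h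

/-- `v(h) ≥ k`. -/
def PolyGE (p : HeightOneSpectrum R) (k : ℤ) (h : K[X]) : Prop := ∀ i, OrdGE p k (h.coeff i)

lemma polyGE_iff : PolyGE p k h ↔ (k : WithTop ℤ) ≤ polyOrd p h := by
  rw [polyOrd, Finset.le_inf_iff]
  refine forall_congr' fun i => ?_
  by_cases hi : h.coeff i = 0
  · simp [hi]
  · simp only [mem_support_iff, ne_eq, hi, not_false_eq_true, forall_const]
    rw [ordGE_iff hi, ordInt, ordAt, if_neg hi, WithTop.coe_le_coe]
    rfl

lemma polyOrd_eq_coe (hh : h ≠ 0) : polyOrd p h = (polyOrdInt p h : WithTop ℤ) := by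
  rw [polyOrdInt]
  have : polyOrd p h ≠ ⊤ := by
    rw [polyOrd, Ne, Finset.inf_eq_top_iff]
    intro H
    obtain ⟨i, hi⟩ := nonempty_support_iff.2 hh
    have := H i hi
    simp [ordAt, mem_support_iff.1 hi] at this
  lift polyOrd p h to ℤ using this with m
  rfl

lemma polyGE_iff_le (hh : h ≠ 0) : PolyGE p k h ↔ k ≤ polyOrdInt p h := by
  rw [polyGE_iff, polyOrd_eq_coe hh, WithTop.coe_le_coe]

@[simp] lemma polyGE_zero : PolyGE p k (0 : K[X]) := fun i => by simp

lemma polyGE_polyOrdInt (h : K[X]) : PolyGE p (polyOrdInt p h) h := by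
  by_cases hh : h = 0
  · simp [hh]
  · exact (polyGE_iff_le hh).2 le_rfl

lemma PolyGE.mono (h1 : PolyGE p k h) (hl : l ≤ k) : PolyGE p l h := fun i => (h1 i).mono hl

lemma PolyGE.add (hf : PolyGE p k f) (hg : PolyGE p k g) : PolyGE p k (f + g) := fun i => by
  rw [coeff_add]; exact (hf i).add (hg i)

lemma PolyGE.sub (hf : PolyGE p k f) (hg : PolyGE p k g) : PolyGE p k (f - g) := fun i => by
  rw [coeff_sub]; exact (hf i).sub (hg i)

lemma PolyGE.mul (hf : PolyGE p k f) (hg : PolyGE p l g) : PolyGE p (k + l) (f * g) := fun i => by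
  rw [coeff_mul]; exact OrdGE.sum fun j _ => (hf _).mul (hg _)

lemma PolyGE.mul_zero (hf : PolyGE p k f) (hg : PolyGE p 0 g) : PolyGE p k (f * g) := by
  simpa using hf.mul hg

lemma PolyGE.sum {ι : Type*} {s : Finset ι} {u : ι → K[X]} (h : ∀ i ∈ s, PolyGE p k (u i)) :
    PolyGE p k (∑ i ∈ s, u i) := fun j => by
  rw [finsetSum_coeff]; exact OrdGE.sum fun i hi => h i hi j

lemma polyGE_C (hx : OrdGE p k x) : PolyGE p k (C x) := fun i => by
  rw [coeff_C]; split_ifs <;> simp [hx]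

lemma polyGE_X : PolyGE p 0 (X : K[X]) := fun i => by
  rw [coeff_X]; split_ifs <;> simp

lemma polyGE_one : PolyGE p 0 (1 : K[X]) := by simpa using polyGE_C (ordGE_one (p := p) (K := K))

lemma PolyGE.pow_zero (hf : PolyGE p 0 f) (n : ℕ) : PolyGE p 0 (f ^ n) := by
  induction n with
  | zero => simpa using polyGE_one
  | succ n ih => rw [pow_succ]; exact ih.mul_zero hf

lemma PolyGE.comp (hf : PolyGE p k f) (hg : PolyGE p 0 g) : PolyGE p k (f.comp g) := by
  rw [Polynomial.comp, eval₂_eq_sum_range]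
  exact PolyGE.sum fun i _ => (polyGE_C (hf i)).mul_zero (hg.pow_zero i)

lemma PolyGE.eval (hf : PolyGE p k f) (hx : OrdGE p 0 x) : OrdGE p k (f.eval x) := by
  rw [eval_eq_sum_range]
  exact OrdGE.sum fun i _ => (hf i).mul_zero (hx.pow_zero i)

/-- Passing to a polynomial over the local ring makes integrality of resultants, Bezout identities
and reductions a matter of base change. -/
lemma PolyGE.exists_map (hf : PolyGE p 0 f) :
    ∃ F : (HeightOneSpectrum.valuationSubringAtPrime K p)[X],
      F.map (algebraMap _ K) = f := by
  have : f ∈ lifts (algebraMap (HeightOneSpectrum.valuationSubringAtPrime K p) K) := by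
    rw [lifts_iff_coeff_lifts]
    exact fun n => ⟨⟨_, mem_valuationSubringAtPrime.2 (hf n)⟩, rfl⟩
  simpa [mem_lifts] using this

lemma PolyGE.resultant (hf : PolyGE p 0 f) (hg : PolyGE p 0 g) (m n : ℕ) :
    OrdGE p 0 (Polynomial.resultant f g m n) := by
  obtain ⟨F, rfl⟩ := hf.exists_map
  obtain ⟨G, rfl⟩ := hg.exists_map
  rw [resultant_map_map]
  exact mem_valuationSubringAtPrime.1 (Subtype.property _)

/-- A Dedekind domain is the intersection of its localizations in K, so integrality can be checked
prime by prime. -/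
lemma mem_lifts_iff_polyGE : f ∈ lifts (algebraMap R K) ↔ ∀ p : HeightOneSpectrum R, PolyGE p 0 f := by
  rw [lifts_iff_coeff_lifts]
  refine ⟨fun h p i => ?_, fun h i => ?_⟩
  · obtain ⟨r, hr⟩ := h i
    rw [← hr]; exact ordGE_algebraMap r
  · obtain ⟨r, hr⟩ := HeightOneSpectrum.mem_integers_of_valuation_le_one (R := R) K (f.coeff i)
      fun p => by simpa [OrdGE] using h p i
    exact ⟨r, hr⟩

/-- Both members of the pair have valuation at least `k`. -/
def PairGE (p : HeightOneSpectrum R) (k : ℤ) (P : K[X] × K[X]) : Prop :=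
  PolyGE p k P.1 ∧ PolyGE p k P.2

lemma isOver_iff_pairGE {P : K[X] × K[X]} :
    IsOver R P ↔ ∀ p : HeightOneSpectrum R, PairGE p 0 P := by
  simp only [IsOver, mem_lifts_iff_polyGE, PairGE, forall_and]

lemma ordInt_of_span_singleton {r : R} (hr : Ideal.span {r} = p.asIdeal) :
    ordInt p (algebraMap R K r) = 1 := by
  have h0 : r ≠ 0 := by
    rintro rfl
    exact p.ne_bot (by rw [← hr]; simp)
  have h1 : algebraMap R K r ≠ 0 := by simpa using h0
  rw [ordInt_of_ne_zero h1, HeightOneSpectrum.valuation_of_algebraMap,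
    p.intValuation_singleton h0 hr.symm]
  simp

/-- Distinct nonzero primes are maximal, so neither contains the other. That π is a unit at every
other prime is what keeps work at p from disturbing q. -/
lemma ordInt_of_span_singleton_ne {q : HeightOneSpectrum R} (hpq : p ≠ q) {r : R}
    (hr : Ideal.span {r} = p.asIdeal) : ordInt q (algebraMap R K r) = 0 := by
  have h0 : r ≠ 0 := by
    rintro rfl
    exact p.ne_bot (by rw [← hr]; simp)
  have h1 : algebraMap R K r ≠ 0 := by simpa using h0
  have h2 : r ∉ q.asIdeal := by
    intro h
    apply hpq
    ext1
    exact p.isMaximal.eq_of_le q.isPrime.ne_top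
      (by rw [← hr, Ideal.span_singleton_le_iff_mem]; exact h)
  rw [ordInt_of_ne_zero h1, (q.valuation_eq_one_iff_notMem).2 h2]
  simp

end OrdGE

/-! ### Resultants under affine substitution and reversal -/

section ResultantTransformation

variable {K : Type*} [Field K]

lemma natDegree_comp_affine {a : K} (ha : a ≠ 0) (b : K) (f : K[X]) :
    (f.comp (C a * X + C b)).natDegree = f.natDegree := by
  rw [natDegree_comp, natDegree_linear ha, mul_one]

lemma coeff_comp_C_mul_X' (a : K) (f : K[X]) (i : ℕ) :
    (f.comp (C a * X)).coeff i = f.coeff i * a ^ i := comp_C_mul_X_coeff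

lemma comp_affine_eq (a b : K) (f : K[X]) :
    f.comp (C a * X + C b) = (taylor b f).comp (C a * X) := by
  rw [taylor_apply, comp_assoc]; simp

lemma coeff_comp_affine (a b : K) {f : K[X]} {d : ℕ} (hf : f.natDegree ≤ d) (j : ℕ) :
    (f.comp (C a * X + C b)).coeff j =
      a ^ j * ∑ i ∈ Finset.Icc j d, (i.choose j : K) * (f.coeff i * b ^ (i - j)) := by
  rw [comp_affine_eq, coeff_comp_C_mul_X', taylor_coeff, mul_comm, hasseDeriv_apply, sum_def,
    eval_finsetSum]
  congr 1
  simp only [eval_monomial]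
  have h1 : ∀ i ∈ Finset.range (d + 1), i ∉ Finset.Icc j d →
      (i.choose j : K) * (f.coeff i * b ^ (i - j)) = 0 := by
    intro i hi hi'
    have : i < j := by
      simp only [Finset.mem_range, Finset.mem_Icc] at hi hi'; omega
    simp [Nat.choose_eq_zero_of_lt this]
  rw [Finset.sum_subset (fun i hi => by simp only [Finset.mem_range, Finset.mem_Icc] at *; omega) h1]
  refine (Finset.sum_subset (fun i hi => ?_) fun i _ hi => ?_).trans
    (Finset.sum_congr rfl fun i _ => by ring)
  · have := (le_natDegree_of_mem_supp i hi).trans hf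
    simp only [Finset.mem_range]; omega
  · simp [notMem_support_iff.1 hi]

lemma coeff_comp_affine_natDegree {a : K} (b : K) {f : K[X]} {d : ℕ}
    (hf : f.natDegree ≤ d) : (f.comp (C a * X + C b)).coeff d = a ^ d * f.coeff d := by
  rw [coeff_comp_affine a b hf]; simp

lemma resultant_comp_affine {a : K} (ha : a ≠ 0) (b : K) (f g : K[X]) :
    resultant (f.comp (C a * X + C b)) (g.comp (C a * X + C b)) =
      a ^ (f.natDegree * g.natDegree) * resultant f g := by
  -- Translation preserves the resultant, and z ↦ az divides the roots by a; the factor a^(deg h)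
  -- restores the leading coefficient.
  have key : ∀ h : K[X], h.comp (C a * X + C b) =
      C (a ^ h.natDegree) * (taylor b h).scaleRoots a⁻¹ := by
    intro h
    rw [comp_affine_eq]
    ext i
    rw [coeff_comp_C_mul_X', coeff_C_mul, coeff_scaleRoots, natDegree_taylor]
    by_cases hi : i ≤ h.natDegree
    · obtain ⟨k, hk⟩ := Nat.exists_eq_add_of_le hi
      rw [hk, Nat.add_sub_cancel_left, pow_add, inv_pow]
      field_simp
    · rw [coeff_eq_zero_of_natDegree_lt (by rw [natDegree_taylor]; omega)]; simp
  have h1 : ∀ h : K[X], (C (a ^ h.natDegree) * (taylor b h).scaleRoots a⁻¹).natDegree =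
      ((taylor b h).scaleRoots a⁻¹).natDegree := fun h => natDegree_C_mul (pow_ne_zero _ ha)
  have h2 := resultant_scaleRoots (taylor b f) (taylor b g) a⁻¹
  rw [key, key, h1, h1, resultant_C_mul_left, resultant_C_mul_right, h2, resultant_taylor]
  simp only [natDegree_scaleRoots, natDegree_taylor, ← pow_mul, mul_comm g.natDegree, inv_pow]
  field_simp

/-- For formal degree d the actual degrees may be smaller. If both are, the resultant vanishes on
both sides; otherwise one degree is d, and lowering the other formal degree only splits off a power
of its leading coefficient, which the substitution multiplies by a^d. -/
lemma resultant_comp_affine_deg {a : K} (ha : a ≠ 0) (b : K) {f g : K[X]} {d : ℕ}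
    (hf : f.natDegree ≤ d) (hg : g.natDegree ≤ d) :
    resultant (f.comp (C a * X + C b)) (g.comp (C a * X + C b)) d d =
      a ^ (d * d) * resultant f g d d := by
  have main : ∀ {f g : K[X]}, f.natDegree = d → g.natDegree ≤ d →
      resultant (f.comp (C a * X + C b)) (g.comp (C a * X + C b)) d d =
      a ^ (d * d) * resultant f g d d := by
    intro f g hf hg
    obtain ⟨k, hk⟩ := Nat.exists_eq_add_of_le hg
    have e1 := resultant_add_right_deg f g d g.natDegree k le_rfl
    have e2 := resultant_add_right_deg (f.comp (C a * X + C b)) (g.comp (C a * X + C b)) d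
      g.natDegree k (natDegree_comp_affine ha b g).le
    have e3 := resultant_comp_affine ha b f g
    rw [natDegree_comp_affine ha, natDegree_comp_affine ha, hf] at e3
    rw [← hk] at e1 e2
    rw [e1, e2, e3, coeff_comp_affine_natDegree b hf.le]
    have : a ^ (d * d) = a ^ (d * g.natDegree) * (a ^ d) ^ k := by
      rw [← pow_mul, ← pow_add, ← mul_add, ← hk]
    rw [this]; ring
  rcases hf.lt_or_eq with h1 | h1
  · rcases hg.lt_or_eq with h2 | h2
    · rw [resultant_eq_zero_of_lt_lt _ _ _ _ h1 h2, resultant_eq_zero_of_lt_lt, mul_zero] <;>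
        rwa [natDegree_comp_affine ha]
    · rw [resultant_comm, main h2 hf, resultant_comm g f, mul_left_comm, ← mul_assoc ((-1) ^ _),
        ← mul_pow]
      simp
  · exact main h1 hg

/-- Reversing the coefficients reverses the rows of the Sylvester matrix and the columns within each
of its two blocks, so the determinant changes by a sign. Squaring avoids computing it. -/
lemma resultant_reflect_sq {R : Type*} [CommRing R] (f g : R[X]) (m n : ℕ) :
    resultant (reflect m f) (reflect n g) m n ^ 2 = resultant f g m n ^ 2 := by
  let σ : Equiv.Perm (Fin (m + n)) :=
    finSumFinEquiv.symm.trans ((Equiv.sumCongr Fin.revPerm Fin.revPerm).trans finSumFinEquiv)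
  have h : sylvester (reflect m f) (reflect n g) m n =
      ((sylvester f g m n).submatrix Fin.revPerm id).submatrix id σ := by
    ext i j
    induction j using Fin.addCases with
    | left j =>
      simp only [sylvester, Matrix.of_apply, Fin.addCases_left, Matrix.submatrix_apply, id, σ,
        Equiv.trans_apply, finSumFinEquiv_symm_apply_castAdd, Equiv.sumCongr_apply, Sum.map_inl,
        finSumFinEquiv_apply_left, Fin.revPerm_apply, Fin.val_rev, coeff_reflect, Set.mem_Icc]
      have hi := i.2
      have hj := j.2
      by_cases hc : (j : ℕ) ≤ i ∧ (i : ℕ) ≤ j + n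
      · rw [if_pos hc, if_pos (by omega), revAt_le (by omega)]
        congr 1; omega
      · rw [if_neg hc, if_neg (by omega)]
    | right j =>
      simp only [sylvester, Matrix.of_apply, Fin.addCases_right, Matrix.submatrix_apply, id, σ,
        Equiv.trans_apply, finSumFinEquiv_symm_apply_natAdd, Equiv.sumCongr_apply, Sum.map_inr,
        finSumFinEquiv_apply_right, Fin.revPerm_apply, Fin.val_rev, coeff_reflect, Set.mem_Icc]
      have hi := i.2
      have hj := j.2
      by_cases hc : (j : ℕ) ≤ i ∧ (i : ℕ) ≤ j + m
      · rw [if_pos hc, if_pos (by omega), revAt_le (by omega)]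
        congr 1; omega
      · rw [if_neg hc, if_neg (by omega)]
  have hs : ∀ τ : Equiv.Perm (Fin (m + n)), (((Equiv.Perm.sign τ : ℤˣ) : ℤ) : R) ^ 2 = 1 := by
    intro τ
    rw [← Int.cast_pow, ← Units.val_pow_eq_pow_val, Int.units_sq]; simp
  rw [resultant, resultant, h, Matrix.det_permute', Matrix.det_permute, mul_pow, mul_pow, hs, hs,
    one_mul, one_mul]

end ResultantTransformation

/-! ### The action on models and its effect on the resultant -/

section Action

variable {K : Type*} [Field K] {d : ℕ}

lemma substForm_add (A : Matrix (Fin 2) (Fin 2) K) (f g : K[X]) :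
    substForm d A (f + g) = substForm d A f + substForm d A g := by
  simp only [substForm, coeff_add, C_add, add_mul, Finset.sum_add_distrib]

lemma substForm_C_mul (A : Matrix (Fin 2) (Fin 2) K) (c : K) (f : K[X]) :
    substForm d A (C c * f) = C c * substForm d A f := by
  simp only [substForm, coeff_C_mul, C_mul, mul_assoc, Finset.mul_sum]

lemma substForm_sub (A : Matrix (Fin 2) (Fin 2) K) (f g : K[X]) :
    substForm d A (f - g) = substForm d A f - substForm d A g := by
  simp only [substForm, coeff_sub, C_sub, sub_mul, Finset.sum_sub_distrib]

lemma substForm_zero (A : Matrix (Fin 2) (Fin 2) K) : substForm d A 0 = 0 := by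
  simp [substForm]

lemma substForm_sum {ι : Type*} (A : Matrix (Fin 2) (Fin 2) K) (s : Finset ι) (u : ι → K[X]) :
    substForm d A (∑ i ∈ s, u i) = ∑ i ∈ s, substForm d A (u i) := by
  classical
  induction s using Finset.induction_on with
  | empty => simp [substForm_zero]
  | insert a s ha ih => rw [Finset.sum_insert ha, Finset.sum_insert ha, substForm_add, ih]

lemma substForm_X_pow (A : Matrix (Fin 2) (Fin 2) K) {i : ℕ} (hi : i ≤ d) :
    substForm d A (X ^ i) =
      (C (A 0 0) * X + C (A 0 1)) ^ i * (C (A 1 0) * X + C (A 1 1)) ^ (d - i) := by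
  rw [substForm, Finset.sum_eq_single i]
  · simp
  · intro j _ hj; simp [coeff_X_pow, hj]
  · intro h; simp only [Finset.mem_range] at h; omega

/-- A product of forms has the sum of their degrees; with these formal degrees, substitution is
multiplicative. This is what lets a second substitution pass through the powers of linear forms
produced by the first. -/
lemma substForm_mul (A : Matrix (Fin 2) (Fin 2) K) {f g : K[X]} {m n : ℕ}
    (hf : f.natDegree ≤ m) (hg : g.natDegree ≤ n) :
    substForm (m + n) A (f * g) = substForm m A f * substForm n A g := by
  have e : f * g = ∑ i ∈ Finset.range (m + 1), ∑ j ∈ Finset.range (n + 1),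
      C (f.coeff i) * (C (g.coeff j) * X ^ (i + j)) := by
    conv_lhs => rw [f.as_sum_range' (m + 1) (by omega), g.as_sum_range' (n + 1) (by omega),
      Finset.sum_mul_sum]
    refine Finset.sum_congr rfl fun i _ => Finset.sum_congr rfl fun j _ => ?_
    rw [← C_mul_X_pow_eq_monomial, ← C_mul_X_pow_eq_monomial, pow_add]; ring
  rw [e, substForm_sum, substForm, substForm, Finset.sum_mul_sum]
  refine Finset.sum_congr rfl fun i hi => ?_
  rw [substForm_sum]
  refine Finset.sum_congr rfl fun j hj => ?_
  simp only [Finset.mem_range] at hi hj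
  rw [substForm_C_mul, substForm_C_mul, substForm_X_pow A (by omega),
    show m + n - (i + j) = (m - i) + (n - j) by omega, pow_add, pow_add]
  ring

lemma natDegree_linear_le' (a b : K) : (C a * X + C b).natDegree ≤ 1 := natDegree_linear_le

lemma substForm_linear (A : Matrix (Fin 2) (Fin 2) K) (a b : K) :
    substForm 1 A (C a * X + C b) =
      C (a * A 0 0 + b * A 1 0) * X + C (a * A 0 1 + b * A 1 1) := by
  simp [substForm, Finset.sum_range_succ]
  ring

lemma substForm_linear_pow (A : Matrix (Fin 2) (Fin 2) K) (a b : K) (n : ℕ) :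
    substForm n A ((C a * X + C b) ^ n) =
      (C (a * A 0 0 + b * A 1 0) * X + C (a * A 0 1 + b * A 1 1)) ^ n := by
  induction n with
  | zero => simp [substForm]
  | succ n ih =>
    rw [pow_succ, substForm_mul A (natDegree_pow_le_of_le n (natDegree_linear_le' a b) |>.trans
      (by simp)) (natDegree_linear_le' a b), ih, substForm_linear, pow_succ]

lemma substForm_substForm (A B : Matrix (Fin 2) (Fin 2) K) (f : K[X]) :
    substForm d B (substForm d A f) = substForm d (A * B) f := by
  conv_lhs => rw [substForm.eq_def d A f]
  rw [substForm_sum, substForm]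
  refine Finset.sum_congr rfl fun i hi => ?_
  simp only [Finset.mem_range] at hi
  have h1 : ∀ (a b : K) (n : ℕ), ((C a * X + C b) ^ n).natDegree ≤ n := fun a b n => by
    simpa using natDegree_pow_le_of_le n (natDegree_linear_le' a b)
  have h := substForm_mul B (h1 (A 0 0) (A 0 1) i) (h1 (A 1 0) (A 1 1) (d - i))
  rw [show i + (d - i) = d by omega] at h
  rw [mul_assoc, substForm_C_mul, h, substForm_linear_pow, substForm_linear_pow]
  simp only [Matrix.mul_apply, Fin.sum_univ_two, mul_assoc]

lemma natDegree_substForm_le (A : Matrix (Fin 2) (Fin 2) K) (f : K[X]) :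
    (substForm d A f).natDegree ≤ d := by
  refine natDegree_sum_le_of_forall_le _ _ fun i hi => ?_
  simp only [Finset.mem_range] at hi
  rw [mul_assoc]
  refine (natDegree_C_mul_le _ _).trans (natDegree_mul_le.trans ?_)
  have h1 := natDegree_pow_le_of_le i (natDegree_linear_le' (A 0 0) (A 0 1))
  have h2 := natDegree_pow_le_of_le (d - i) (natDegree_linear_le' (A 1 0) (A 1 1))
  omega

lemma natDegree_C_mul_add_le {f g : K[X]} (hf : f.natDegree ≤ d) (hg : g.natDegree ≤ d)
    (a b : K) : (C a * f + C b * g).natDegree ≤ d :=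
  natDegree_add_le_of_degree_le ((natDegree_C_mul_le _ _).trans hf)
    ((natDegree_C_mul_le _ _).trans hg)

lemma natDegree_actModel_fst_le (l : K) (A : Matrix (Fin 2) (Fin 2) K) (P : K[X] × K[X]) :
    (actModel d l A P).1.natDegree ≤ d := by
  refine (natDegree_C_mul_le _ _).trans ?_
  rw [sub_eq_add_neg, ← neg_mul, ← C_neg]
  exact natDegree_C_mul_add_le (natDegree_substForm_le _ _) (natDegree_substForm_le _ _) _ _

lemma natDegree_actModel_snd_le (l : K) (A : Matrix (Fin 2) (Fin 2) K) (P : K[X] × K[X]) :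
    (actModel d l A P).2.natDegree ≤ d := by
  refine (natDegree_C_mul_le _ _).trans ?_
  rw [← C_neg]
  exact natDegree_C_mul_add_le (natDegree_substForm_le _ _) (natDegree_substForm_le _ _) _ _

lemma actModel_actModel (l m : K) (A B : Matrix (Fin 2) (Fin 2) K) (P : K[X] × K[X]) :
    actModel d m B (actModel d l A P) = actModel d (m * l) (A * B) P := by
  ext1
  · simp only [actModel, substForm_sub, substForm_add, substForm_C_mul, substForm_substForm,
      Matrix.mul_apply, Fin.sum_univ_two, C_mul, C_add, ← C_neg]
    simp only [C_neg]
    ring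
  · simp only [actModel, substForm_sub, substForm_add, substForm_C_mul, substForm_substForm,
      Matrix.mul_apply, Fin.sum_univ_two, C_mul, C_add, ← C_neg]
    simp only [C_neg]
    ring

/-- Substitution into forms of degree d contributes s^d, and the adjugate contributes one more
factor s. This reduces triangular matrices to those with lower right entry 1. -/
lemma actModel_smul (l s : K) (A : Matrix (Fin 2) (Fin 2) K) (P : K[X] × K[X]) :
    actModel d l (s • A) P = actModel d (l * s ^ (d + 1)) A P := by
  have h : ∀ f : K[X], substForm d (s • A) f = C (s ^ d) * substForm d A f := by
    intro f
    rw [substForm, substForm, Finset.mul_sum]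
    refine Finset.sum_congr rfl fun i hi => ?_
    simp only [Finset.mem_range] at hi
    have e : ∀ a b : K, C (s * a) * X + C (s * b) = C s * (C a * X + C b) := by
      intro a b; simp only [C_mul]; ring
    simp only [Matrix.smul_apply, smul_eq_mul, e, mul_pow]
    rw [← show i + (d - i) = d by omega, pow_add]
    simp only [C_mul, C_pow, show i + (d - i) - i = d - i by omega]
    ring
  ext1
  · simp only [actModel, h, Matrix.smul_apply, smul_eq_mul, C_mul, C_pow]; ring
  · simp only [actModel, h, Matrix.smul_apply, smul_eq_mul, C_mul, C_pow]; ring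

lemma substForm_affine (a b : K) {f : K[X]} (hf : f.natDegree ≤ d) :
    substForm d !![a, b; 0, 1] f = f.comp (C a * X + C b) := by
  rw [Polynomial.comp, eval₂_eq_sum_range' C (Nat.lt_succ_of_le hf)]
  simp [substForm]

lemma actModel_affine (l a b : K) {P : K[X] × K[X]} (h1 : P.1.natDegree ≤ d)
    (h2 : P.2.natDegree ≤ d) :
    actModel d l !![a, b; 0, 1] P =
      (C l * (P.1.comp (C a * X + C b) - C b * P.2.comp (C a * X + C b)),
        C l * (C a * P.2.comp (C a * X + C b))) := by
  simp [actModel, substForm_affine a b h1, substForm_affine a b h2]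

lemma actModel_scalar (l : K) {P : K[X] × K[X]} (h1 : P.1.natDegree ≤ d)
    (h2 : P.2.natDegree ≤ d) : actModel d l 1 P = (C l * P.1, C l * P.2) := by
  rw [Matrix.one_fin_two, actModel_affine l 1 0 h1 h2]
  simp

/-- The substitution contributes a^(d²), the factor a on the second form a^d, and l on both forms
l^(2d); subtracting b times the second form from the first does not change the resultant. -/
lemma modelRes_affine (l : K) {a : K} (ha : a ≠ 0) (b : K) {P : K[X] × K[X]}
    (h1 : P.1.natDegree ≤ d) (h2 : P.2.natDegree ≤ d) :
    modelRes d (actModel d l !![a, b; 0, 1] P) =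
      l ^ (2 * d) * a ^ (d * d + d) * modelRes d P := by
  have e : P.1.comp (C a * X + C b) - C b * P.2.comp (C a * X + C b) =
      P.1.comp (C a * X + C b) + P.2.comp (C a * X + C b) * C (-b) := by
    rw [C_neg]; ring
  rw [actModel_affine l a b h1 h2, modelRes, resultant_C_mul_left, resultant_C_mul_right,
    resultant_C_mul_right, e, resultant_add_mul_left, resultant_comp_affine_deg ha b h1 h2, modelRes]
  · ring
  · simp
  · rwa [natDegree_comp_affine ha]

lemma substForm_swap {f : K[X]} (hf : f.natDegree ≤ d) :
    substForm d !![0, 1; 1, 0] f = reflect d f := by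
  have e : substForm d !![0, 1; 1, 0] f =
      ∑ i ∈ Finset.range (d + 1), C (f.coeff i) * X ^ (d - i) := by
    simp [substForm]
  ext j
  rw [e, finsetSum_coeff, coeff_reflect]
  simp only [coeff_C_mul, coeff_X_pow]
  by_cases hj : j ≤ d
  · rw [revAt_le hj, Finset.sum_eq_single (d - j)]
    · rw [if_pos (by omega), mul_one]
    · intro i hi hij
      simp only [Finset.mem_range] at hi
      rw [if_neg (by omega), mul_zero]
    · intro h; simp only [Finset.mem_range] at h; omega
  · rw [Finset.sum_eq_zero, revAt_eq_self_of_lt (by omega),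
      coeff_eq_zero_of_natDegree_lt (by omega)]
    intro i hi
    rw [if_neg (by omega), mul_zero]

lemma modelRes_swap_sq (l : K) {P : K[X] × K[X]} (h1 : P.1.natDegree ≤ d)
    (h2 : P.2.natDegree ≤ d) :
    modelRes d (actModel d l !![0, 1; 1, 0] P) ^ 2 = (l ^ (2 * d) * modelRes d P) ^ 2 := by
  have e : actModel d l !![0, 1; 1, 0] P =
      (C (-l) * reflect d P.2, C (-l) * reflect d P.1) := by
    simp [actModel, substForm_swap h1, substForm_swap h2]
  have hs : ((-1 : K) ^ (d * d)) ^ 2 = 1 := by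
    rw [← pow_mul, mul_comm, pow_mul, neg_one_sq, one_pow]
  have hl : ((-l) ^ d) ^ 2 = (l ^ d) ^ 2 := by
    rw [← pow_mul, ← pow_mul, mul_comm, pow_mul, pow_mul, neg_sq]
  rw [e, modelRes, resultant_C_mul_left, resultant_C_mul_right, resultant_comm, modelRes]
  simp only [mul_pow, resultant_reflect_sq, hs, hl]
  ring

/-- The resultant of a transformed model, up to sign. -/
lemma modelRes_actModel_sq {l : K} {A : Matrix (Fin 2) (Fin 2) K}
    (hA : A.det ≠ 0) {P : K[X] × K[X]} (h1 : P.1.natDegree ≤ d) (h2 : P.2.natDegree ≤ d) :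
    modelRes d (actModel d l A P) ^ 2 =
      (l ^ (2 * d) * A.det ^ (d * d + d) * modelRes d P) ^ 2 := by
  have upper : ∀ {a b e l : K} {P : K[X] × K[X]}, a ≠ 0 → e ≠ 0 → P.1.natDegree ≤ d →
      P.2.natDegree ≤ d → modelRes d (actModel d l !![a, b; 0, e] P) ^ 2 =
      (l ^ (2 * d) * (a * e) ^ (d * d + d) * modelRes d P) ^ 2 := by
    intro a b e l P ha he h1 h2
    have hs : !![a, b; 0, e] = e • !![a / e, b / e; 0, 1] := by
      ext i j; fin_cases i <;> fin_cases j <;> simp <;> field_simp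
    rw [hs, actModel_smul, modelRes_affine _ (div_ne_zero ha he) _ h1 h2]
    congr 2
    have : (e ^ (d + 1)) ^ (2 * d) = e ^ (d * d + d) * e ^ (d * d + d) := by
      rw [← pow_mul, ← pow_add]; congr 1; ring
    rw [mul_pow, this, div_pow, mul_pow]
    field_simp
  by_cases hc : A 1 0 = 0
  · have hA' : A = !![A 0 0, A 0 1; 0, A 1 1] := by
      rw [← hc]; exact A.eta_fin_two
    rw [Matrix.det_fin_two, hc, mul_zero, sub_zero] at hA
    rw [hA', upper (left_ne_zero_of_mul hA) (right_ne_zero_of_mul hA) h1 h2, ← hA',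
      Matrix.det_fin_two, hc, mul_zero, sub_zero]
  -- Bruhat decomposition: a matrix with nonzero lower left entry is a product of an upper
  -- triangular matrix, the swap and another upper triangular matrix.
  · have hA' : A = !![1, A 0 0 / A 1 0; 0, 1] * !![0, 1; 1, 0] *
        !![A 1 0, A 1 1; 0, -A.det / A 1 0] := by
      rw [Matrix.det_fin_two]
      ext i j; fin_cases i <;> fin_cases j <;> simp [Matrix.mul_apply] <;> field_simp
      ring
    have e : actModel d l A P = actModel d l !![A 1 0, A 1 1; 0, -A.det / A 1 0]
        (actModel d 1 !![0, 1; 1, 0] (actModel d 1 !![1, A 0 0 / A 1 0; 0, 1] P)) := by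
      rw [actModel_actModel, actModel_actModel, mul_one, mul_one, ← Matrix.mul_assoc, ← hA']
    rw [e, upper hc (div_ne_zero (neg_ne_zero.2 hA) hc) (natDegree_actModel_fst_le _ _ _)
      (natDegree_actModel_snd_le _ _ _), mul_pow, modelRes_swap_sq _
      (natDegree_actModel_fst_le _ _ _) (natDegree_actModel_snd_le _ _ _),
      modelRes_affine _ one_ne_zero _ h1 h2, mul_div_cancel₀ _ hc]
    -- The last triangular factor has determinant -det A; the even exponent removes the sign.
    have : Even (d * d + d) := by rw [← mul_add_one]; exact Nat.even_mul_succ_self d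
    rw [this.neg_pow]
    ring

lemma actModel_inv {l : K} (hl : l ≠ 0) {A : Matrix (Fin 2) (Fin 2) K} (hA : A.det ≠ 0)
    {P : K[X] × K[X]} (h1 : P.1.natDegree ≤ d) (h2 : P.2.natDegree ≤ d) :
    actModel d l⁻¹ A⁻¹ (actModel d l A P) = P := by
  rw [actModel_actModel, Matrix.mul_nonsing_inv _ (isUnit_iff_ne_zero.2 hA), inv_mul_cancel₀ hl,
    actModel_scalar _ h1 h2]
  simp

lemma IsModel.actModel {P : K[X] × K[X]} (hP : IsModel d P) {l : K} (hl : l ≠ 0)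
    {A : Matrix (Fin 2) (Fin 2) K} (hA : A.det ≠ 0) : IsModel d (actModel d l A P) := by
  refine ⟨natDegree_actModel_fst_le _ _ _, natDegree_actModel_snd_le _ _ _, fun h => ?_⟩
  have := modelRes_actModel_sq (l := l) hA hP.1 hP.2.1
  rw [h, zero_pow two_ne_zero, eq_comm, pow_eq_zero_iff two_ne_zero] at this
  exact mul_ne_zero (mul_ne_zero (pow_ne_zero _ hl) (pow_ne_zero _ hA)) hP.2.2 this

lemma sameClass_iff {P Q : K[X] × K[X]} : SameClass d P Q ↔
    ∃ (l : K) (A : Matrix (Fin 2) (Fin 2) K), l ≠ 0 ∧ A.det ≠ 0 ∧ Q = actModel d l A P := by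
  constructor
  · rintro ⟨l, A, h⟩
    exact ⟨l, A, l.ne_zero, A.det_ne_zero, h⟩
  · rintro ⟨l, A, hl, hA, h⟩
    exact ⟨Units.mk0 l hl, Matrix.GeneralLinearGroup.mkOfDetNeZero A hA, h⟩

lemma SameClass.trans {P Q S : K[X] × K[X]} (h1 : SameClass d P Q) (h2 : SameClass d Q S) :
    SameClass d P S := by
  rw [sameClass_iff] at *
  obtain ⟨l, A, hl, hA, rfl⟩ := h1
  obtain ⟨m, B, hm, hB, rfl⟩ := h2
  exact ⟨m * l, A * B, mul_ne_zero hm hl, by rw [Matrix.det_mul]; exact mul_ne_zero hA hB,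
    actModel_actModel _ _ _ _ _⟩

lemma SameClass.symm {P Q : K[X] × K[X]} (hP : IsModel d P) (h : SameClass d P Q) :
    SameClass d Q P := by
  rw [sameClass_iff] at *
  obtain ⟨l, A, hl, hA, rfl⟩ := h
  refine ⟨l⁻¹, A⁻¹, inv_ne_zero hl, ?_, (actModel_inv hl hA hP.1 hP.2.1).symm⟩
  rw [Matrix.det_nonsing_inv]
  simpa using hA

lemma SameClass.isModel {P Q : K[X] × K[X]} (hP : IsModel d P) (h : SameClass d P Q) :
    IsModel d Q := by
  obtain ⟨l, A, hl, hA, rfl⟩ := sameClass_iff.1 h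
  exact hP.actModel hl hA

end Action

/-! ### Values of depth-bounded computations -/

section EventualValues

open Filter

lemma eventually_atTop_of_succ {P : ℕ → Prop} (h : ∀ᶠ n in atTop, P (n + 1)) :
    ∀ᶠ n in atTop, P n := by
  obtain ⟨N, hN⟩ := eventually_atTop.1 h
  refine eventually_atTop.2 ⟨N + 1, fun n hn => ?_⟩
  obtain ⟨m, rfl⟩ := Nat.exists_eq_add_of_le' (show 1 ≤ n by omega)
  exact hN m (by omega)

/-- Only finitely many calls occur, so one depth bound serves for all of them. Neither the order of
the list nor monotonicity in the bound plays a role. -/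
lemma firstSuccess_spec {α γ : Type*} {body : ℕ → α → Option (Option γ)} {l : List α}
    (h : ∀ a ∈ l, ∃ o, ∀ᶠ n in atTop, body n a = some o) :
    ∃ o, (∀ᶠ n in atTop, firstSuccess (body n) l = some o) ∧
      (∀ c, o = some c → ∃ a ∈ l, ∀ᶠ n in atTop, body n a = some (some c)) ∧
      (o = none → ∀ a ∈ l, ∀ᶠ n in atTop, body n a = some none) := by
  induction l with
  | nil => exact ⟨none, by simp [firstSuccess], by simp, by simp⟩
  | cons a l ih =>
    obtain ⟨o, ho⟩ := h a List.mem_cons_self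
    cases o with
    | some c =>
      refine ⟨some c, ?_, fun c' hc => ⟨a, List.mem_cons_self, ?_⟩, by simp⟩
      · filter_upwards [ho] with n hn
        simp [firstSuccess, hn]
      · rw [← hc]; exact ho
    | none =>
      obtain ⟨o, h1, h2, h3⟩ := ih fun b hb => h b (List.mem_cons_of_mem _ hb)
      refine ⟨o, ?_, fun c hc => ?_, fun hn b hb => ?_⟩
      · filter_upwards [ho, h1] with n hn hn'
        simp [firstSuccess, hn, hn']
      · obtain ⟨b, hb, hb'⟩ := h2 c hc
        exact ⟨b, List.mem_cons_of_mem _ hb, hb'⟩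
      · rcases List.mem_cons.1 hb with rfl | hb
        · exact ho
        · exact h3 hn b hb

end EventualValues

/-! ### Greatest common divisors of lists of polynomials -/

section GcdList

variable {k : Type*} [Field k] [DecidableEq k]

open Classical in
lemma foldr_gcd_dvd {l : List k[X]} {f : k[X]} (hf : f ∈ l) :
    l.foldr (fun a b => EuclideanDomain.gcd a b) 0 ∣ f := by
  induction l with
  | nil => simp at hf
  | cons a l ih =>
    rw [List.foldr_cons]
    rcases List.mem_cons.1 hf with rfl | hf
    · exact EuclideanDomain.gcd_dvd_left _ _
    · exact (EuclideanDomain.gcd_dvd_right _ _).trans (ih hf)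

open Classical in
lemma dvd_foldr_gcd {l : List k[X]} {h : k[X]} (hl : ∀ f ∈ l, h ∣ f) :
    h ∣ l.foldr (fun a b => EuclideanDomain.gcd a b) 0 := by
  induction l with
  | nil => simp
  | cons a l ih =>
    rw [List.foldr_cons]
    exact EuclideanDomain.dvd_gcd (hl a List.mem_cons_self)
      (ih fun f hf => hl f (List.mem_cons_of_mem _ hf))

end GcdList

/-! ### Correctness and termination of the search for solutions of inequalities -/

section Inequalities

variable {R : Type*} [CommRing R] [IsDedekindDomain R]
variable {K : Type*} [Field K] [Algebra R K] [IsFractionRing R K]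
variable {p : HeightOneSpectrum R}

open Filter

/-- `v(x) > c`, including the case `x = 0`. -/
def OrdGT (p : HeightOneSpectrum R) (c : ℝ) (x : K) : Prop := OrdGE p (⌊c⌋ + 1) x

/-- Valuations are integers, so exceeding the real number c means being at least ⌊c⌋ + 1. -/
lemma ordGT_iff {c : ℝ} {x : K} (hx : x ≠ 0) : OrdGT p c x ↔ c < ordInt p x := by
  rw [OrdGT, ordGE_iff hx, Int.add_one_le_iff, Int.floor_lt]

@[simp] lemma ordGT_zero {c : ℝ} : OrdGT p c (0 : K) := ordGE_zero

lemma OrdGE.ordGT {c : ℝ} {k : ℤ} {x : K} (h : OrdGE p k x) (hc : c < k) : OrdGT p c x :=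
  h.mono (by rw [Int.add_one_le_iff, Int.floor_lt]; exact hc)

lemma ordGE_mul_iff {a x : K} (ha : a ≠ 0) {k : ℤ} :
    OrdGE p k (a * x) ↔ OrdGE p (k - ordInt p a) x := by
  by_cases hx : x = 0
  · simp [hx]
  · rw [ordGE_iff hx, ordGE_iff (mul_ne_zero ha hx), ordInt_mul ha hx]
    constructor <;> intro h <;> linarith

lemma ordGT_mul_iff {a x : K} (ha : a ≠ 0) {c : ℝ} :
    OrdGT p c (a * x) ↔ OrdGT p (c - ordInt p a) x := by
  rw [OrdGT, OrdGT, ordGE_mul_iff ha, Int.floor_sub_intCast]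
  ring_nf

lemma polyGE_C_mul_iff {a : K} (ha : a ≠ 0) {k : ℤ} {h : K[X]} :
    PolyGE p k (C a * h) ↔ PolyGE p (k - ordInt p a) h := by
  simp only [PolyGE, coeff_C_mul, ordGE_mul_iff ha]

/-- All conditions `v(h(x)) > c` of the list hold. -/
def SatisfiesConds (p : HeightOneSpectrum R) (V : List (K[X] × ℝ)) (x : K) : Prop :=
  ∀ q ∈ V, OrdGT p q.2 (q.1.eval x)

lemma redAt_of_ordGE {x : K} (hx : OrdGE p 0 x) :
    redAt p x = IsLocalRing.residue (HeightOneSpectrum.valuationSubringAtPrime K p)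
      ⟨x, mem_valuationSubringAtPrime.2 hx⟩ := by
  rw [redAt, dif_pos]

@[simp] lemma redAt_zero : redAt p (0 : K) = 0 := by
  rw [redAt_of_ordGE ordGE_zero]
  exact map_zero _

lemma redAt_eq_zero_iff {x : K} (hx : OrdGE p 0 x) : redAt p x = 0 ↔ OrdGE p 1 x := by
  rw [redAt_of_ordGE hx, IsLocalRing.residue_eq_zero_iff, IsLocalRing.mem_maximalIdeal,
    mem_nonunits_iff]
  constructor
  · intro h
    by_contra h1
    have hx0 : x ≠ 0 := by rintro rfl; simp at h1
    rw [ordGE_iff hx0] at h1 hx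
    refine h (isUnit_iff_exists_inv.2 ⟨⟨x⁻¹, mem_valuationSubringAtPrime.2 ?_⟩, ?_⟩)
    · rw [ordGE_iff (inv_ne_zero hx0), ordInt_inv hx0]; omega
    · exact Subtype.ext (mul_inv_cancel₀ hx0)
  · intro h1 hu
    obtain ⟨⟨w, hw⟩, hxw⟩ := isUnit_iff_exists_inv.1 hu
    have e : x * w = 1 := congrArg Subtype.val hxw
    have := h1.mul (mem_valuationSubringAtPrime.1 hw)
    rw [e, ordGE_iff one_ne_zero, ordInt_one] at this
    omega

lemma redAt_sub {x y : K} (hx : OrdGE p 0 x) (hy : OrdGE p 0 y) :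
    redAt p (x - y) = redAt p x - redAt p y := by
  rw [redAt_of_ordGE hx, redAt_of_ordGE hy, redAt_of_ordGE (hx.sub hy), ← map_sub]
  rfl

lemma coeff_redPoly (h : K[X]) (i : ℕ) : (redPoly p h).coeff i = redAt p (h.coeff i) := by
  rw [redPoly, finsetSum_coeff]
  simp only [coeff_monomial]
  rw [Finset.sum_ite_eq' h.support i]
  split_ifs with hi
  · rfl
  · rw [notMem_support_iff.1 hi, redAt_zero]

lemma eval_redPoly {h : K[X]} (hh : PolyGE p 0 h) {x : K} (hx : OrdGE p 0 x) :
    (redPoly p h).eval (redAt p x) = redAt p (h.eval x) := by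
  obtain ⟨F, rfl⟩ := hh.exists_map
  have e : redPoly p (F.map (algebraMap _ K)) = F.map (IsLocalRing.residue _) := by
    ext i
    rw [coeff_redPoly, coeff_map, coeff_map, redAt_of_ordGE (by simpa using hh i)]
    rfl
  have e2 : (F.map (algebraMap (HeightOneSpectrum.valuationSubringAtPrime K p) K)).eval x =
      algebraMap _ K (F.eval ⟨x, mem_valuationSubringAtPrime.2 hx⟩) := by
    rw [eval_map, ← eval₂_at_apply]; rfl
  rw [e, redAt_of_ordGE hx, redAt_of_ordGE (hh.eval hx), eval_map_apply]
  congr 1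
  exact Subtype.ext e2.symm

lemma redPoly_eq_zero_iff {h : K[X]} (hh : PolyGE p 0 h) : redPoly p h = 0 ↔ PolyGE p 1 h := by
  rw [Polynomial.ext_iff]
  refine forall_congr' fun i => ?_
  rw [coeff_redPoly, coeff_zero, redAt_eq_zero_iff (hh i)]

variable (ch : Choices R K)

lemma Choices.ordInt_gen (p : HeightOneSpectrum R) : ordInt p (algebraMap R K (ch.gen p)) = 1 :=
  ordInt_of_span_singleton (ch.span_gen p)

lemma Choices.gen_ne_zero (p : HeightOneSpectrum R) : algebraMap R K (ch.gen p) ≠ 0 := by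
  intro h
  have := ch.ordInt_gen p
  rw [h, ordInt_zero] at this
  omega

lemma Choices.ordInt_gen_zpow (p : HeightOneSpectrum R) (n : ℤ) :
    ordInt p (algebraMap R K (ch.gen p) ^ n) = n := by
  rw [ordInt_zpow (ch.gen_ne_zero p), ch.ordInt_gen, mul_one]

lemma Choices.gen_zpow_ne_zero (p : HeightOneSpectrum R) (n : ℤ) :
    algebraMap R K (ch.gen p) ^ n ≠ 0 := zpow_ne_zero _ (ch.gen_ne_zero p)

lemma mem_normalizeConds {V : List (K[X] × ℝ)} {q : K[X] × ℝ} :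
    q ∈ normalizeConds p (ch.gen p) V ↔ ∃ r ∈ V, (r.1 ≠ 0 ∧ (polyOrdInt p r.1 : ℝ) ≤ r.2) ∧
      (C ((algebraMap R K (ch.gen p)) ^ (-polyOrdInt p r.1)) * r.1, r.2 - polyOrdInt p r.1) = q := by
  simp only [normalizeConds, List.mem_map, List.mem_filter, decide_eq_true_eq]
  constructor
  · rintro ⟨r, ⟨h1, h2⟩, h3⟩; exact ⟨r, h1, h2, h3⟩
  · rintro ⟨r, h1, h2, h3⟩; exact ⟨r, ⟨h1, h2⟩, h3⟩

lemma normalizeConds_spec {V : List (K[X] × ℝ)} {q : K[X] × ℝ}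
    (hq : q ∈ normalizeConds p (ch.gen p) V) :
    PolyGE p 0 q.1 ∧ ¬ PolyGE p 1 q.1 ∧ 0 ≤ q.2 := by
  obtain ⟨r, _, ⟨h1, h2⟩, rfl⟩ := (mem_normalizeConds ch).1 hq
  have h0 := ch.gen_zpow_ne_zero p (-polyOrdInt p r.1)
  refine ⟨?_, ?_, by simpa using h2⟩
  · rw [polyGE_C_mul_iff h0, ch.ordInt_gen_zpow, polyGE_iff_le h1]; omega
  · rw [polyGE_C_mul_iff h0, ch.ordInt_gen_zpow, polyGE_iff_le h1]; omega

/-- The dropped conditions hold at every integral x: there v(h(x)) ≥ v(h) > c, or h = 0. Integrality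
of x is needed only for these. -/
lemma satisfiesConds_normalizeConds {V : List (K[X] × ℝ)} {x : K} (hx : OrdGE p 0 x) :
    SatisfiesConds p (normalizeConds p (ch.gen p) V) x ↔ SatisfiesConds p V x := by
  have key : ∀ r : K[X] × ℝ,
      OrdGT p (r.2 - polyOrdInt p r.1)
        ((C ((algebraMap R K (ch.gen p)) ^ (-polyOrdInt p r.1)) * r.1).eval x) ↔
      OrdGT p r.2 (r.1.eval x) := by
    intro r
    rw [eval_mul, eval_C, ordGT_mul_iff (ch.gen_zpow_ne_zero p _), ch.ordInt_gen_zpow]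
    push_cast; ring_nf
  constructor
  · intro h r hr
    by_cases hc : r.1 ≠ 0 ∧ (polyOrdInt p r.1 : ℝ) ≤ r.2
    · exact (key r).1 (h _ ((mem_normalizeConds ch).2 ⟨r, hr, hc, rfl⟩))
    · by_cases h0 : r.1 = 0
      · simp [h0]
      · exact ((polyGE_polyOrdInt r.1).eval hx).ordGT (not_le.1 fun h => hc ⟨h0, h⟩)
  · intro h q hq
    obtain ⟨r, hr, _, rfl⟩ := (mem_normalizeConds ch).1 hq
    exact (key r).2 (h r hr)

lemma satisfiesConds_shiftConds {V : List (K[X] × ℝ)} {β : R} {x : K} :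
    SatisfiesConds p (shiftConds (ch.gen p) β V) x ↔
      SatisfiesConds p V (algebraMap R K β + algebraMap R K (ch.gen p) * x) := by
  have hg := ch.gen_ne_zero p
  simp only [SatisfiesConds, shiftConds, List.forall_mem_map]
  refine forall₂_congr fun q _ => ?_
  rw [eval_mul, eval_C, ordGT_mul_iff (inv_ne_zero hg), ordInt_inv hg, ch.ordInt_gen, eval_comp]
  simp

/-- The constant coefficient of h(β + πz) is h(β), divisible by π because β is a root modulo p;
every other coefficient carries a positive power of π. -/
lemma polyGE_shift {h : K[X]} (hh : PolyGE p 0 h) {β : R}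
    (hβ : (redPoly p h).eval (redAt p (algebraMap R K β)) = 0) :
    PolyGE p 0 (C ((algebraMap R K (ch.gen p))⁻¹) *
      h.comp (C (algebraMap R K β) + C (algebraMap R K (ch.gen p)) * X)) := by
  have hg := ch.gen_ne_zero p
  have hβ0 := ordGE_algebraMap (p := p) (K := K) β
  rw [polyGE_C_mul_iff (inv_ne_zero hg), ordInt_inv hg, ch.ordInt_gen]
  rw [eval_redPoly hh hβ0, redAt_eq_zero_iff (hh.eval hβ0)] at hβ
  intro i
  rw [add_comm (C _), coeff_comp_affine _ _ le_rfl]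
  have hgi := (ordGE_ordInt (p := p) (algebraMap R K (ch.gen p))).pow i
  rw [ch.ordInt_gen] at hgi
  rcases Nat.eq_zero_or_pos i with rfl | hi
  · rw [pow_zero, one_mul]
    rw [eval_eq_sum_range] at hβ
    convert hβ using 1
    · norm_num
    · rw [Finset.range_eq_Ico]
      refine Finset.sum_congr ?_ fun j _ => by simp
      ext j; simp only [Finset.mem_Icc, Finset.mem_Ico]; omega
  · refine OrdGE.mul_zero (hgi.mono (by omega)) (OrdGE.sum fun j _ => ?_)
    refine OrdGE.mul_zero ?_ ((hh j).mul_zero (hβ0.pow_zero _))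
    rw [← map_natCast (algebraMap R K)]
    exact ordGE_algebraMap _

/-- Induction on a strict upper bound M for the thresholds: normalization does not raise them for
integral polynomials and the shift lowers them by 1; for M = 0 every condition is vacuous. Nothing
is lost, since a solution reduces to a common root of all reductions, hence to a root of their gcd.
Solutions are excluded in all of the local ring, although those found lie in R. -/
theorem inequalitySolutions_spec (M : ℕ) (V : List (K[X] × ℝ)) (hV : ∀ q ∈ V, PolyGE p 0 q.1)
    (hM : ∀ q ∈ V, q.2 < M) :
    ∃ o : Option R, (∀ᶠ n in atTop, inequalitySolutions ch p n V = some o) ∧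
      (∀ β, o = some β → SatisfiesConds p V (algebraMap R K β)) ∧
      (o = none → ∀ x : K, OrdGE p 0 x → ¬ SatisfiesConds p V x) := by
  classical
  induction M generalizing V with
  | zero =>
    have hV' : normalizeConds p (ch.gen p) V = [] := by
      rw [List.eq_nil_iff_forall_not_mem]
      intro q hq
      obtain ⟨r, hr, ⟨h1, h2⟩, _⟩ := (mem_normalizeConds ch).1 hq
      have h3 := hM r hr
      have h4 : (0 : ℝ) ≤ polyOrdInt p r.1 := by
        exact_mod_cast (polyGE_iff_le h1).1 (hV r hr)
      simp only [CharP.cast_eq_zero] at h3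
      linarith
    refine ⟨some 0, eventually_atTop_of_succ (.of_forall fun n => ?_), ?_, by simp⟩
    · simp only [inequalitySolutions, hV', if_true]
    · rintro β hβ
      rw [← satisfiesConds_normalizeConds ch (ordGE_algebraMap β), hV']
      simp [SatisfiesConds]
  | succ M ih =>
    by_cases hV' : normalizeConds p (ch.gen p) V = []
    · refine ⟨some 0, eventually_atTop_of_succ (.of_forall fun n => ?_), ?_, by simp⟩
      · simp only [inequalitySolutions, hV', if_true]
      · rintro β hβ
        rw [← satisfiesConds_normalizeConds ch (ordGE_algebraMap β), hV']
        simp [SatisfiesConds]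
    set V' := normalizeConds p (ch.gen p) V with hVdef
    set gbar : (ResidueAt K p)[X] :=
      (V'.map fun q => redPoly p q.1).foldr (fun a b => EuclideanDomain.gcd a b) 0 with hgbar
    have hdvd : ∀ q ∈ V', gbar ∣ redPoly p q.1 := fun q hq =>
      foldr_gcd_dvd (List.mem_map.2 ⟨q, hq, rfl⟩)
    -- The roots of the zero polynomial are by convention the empty multiset, so the search is
    -- meaningful only because normalized polynomials have nonzero reduction.
    have hgbar0 : gbar ≠ 0 := by
      obtain ⟨q, hq⟩ := List.exists_mem_of_ne_nil _ hV'
      obtain ⟨h1, h2, _⟩ := normalizeConds_spec ch hq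
      exact ne_zero_of_dvd_ne_zero (mt (redPoly_eq_zero_iff h1).1 h2) (hdvd q hq)
    set W : List R := (ch.rootOrder p gbar.roots.toFinset).map (ch.rep p) with hW
    have hWroot : ∀ β ∈ W, ∀ q ∈ V',
        (redPoly p q.1).eval (redAt p (algebraMap R K β)) = 0 := by
      intro β hβ q hq
      obtain ⟨r, hr, rfl⟩ := List.mem_map.1 hβ
      rw [(ch.rootOrder_spec p _).2, Multiset.mem_toFinset, mem_roots hgbar0] at hr
      rw [ch.red_rep]
      exact eval_eq_zero_of_dvd_of_eval_eq_zero (hdvd q hq) hr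
    have hstep : ∀ β ∈ W, ∃ o : Option R,
        (∀ᶠ n in atTop, inequalitySolutions ch p n (shiftConds (ch.gen p) β V') = some o) ∧
        (∀ γ, o = some γ →
          SatisfiesConds p (shiftConds (ch.gen p) β V') (algebraMap R K γ)) ∧
        (o = none → ∀ x : K, OrdGE p 0 x →
          ¬ SatisfiesConds p (shiftConds (ch.gen p) β V') x) := by
      intro β hβ
      refine ih _ ?_ ?_
      · simp only [shiftConds, List.forall_mem_map]
        exact fun q hq => polyGE_shift ch (normalizeConds_spec ch hq).1 (hWroot β hβ q hq)
      · simp only [shiftConds, List.forall_mem_map]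
        intro q hq
        obtain ⟨r, hr, ⟨h1, _⟩, rfl⟩ := (mem_normalizeConds ch).1 hq
        have h3 := hM r hr
        have h4 : (0 : ℝ) ≤ polyOrdInt p r.1 := by
          exact_mod_cast (polyGE_iff_le h1).1 (hV r hr)
        push_cast at h3
        linarith
    obtain ⟨o, ho1, ho2, ho3⟩ := firstSuccess_spec
      (body := fun n β₀ => (inequalitySolutions ch p n (shiftConds (ch.gen p) β₀ V')).map fun o =>
          o.map fun β₁ => β₀ + ch.gen p * β₁) (l := W) (by
        intro β hβ
        obtain ⟨o, ho, _⟩ := hstep β hβ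
        exact ⟨_, ho.mono fun n hn => by simp only [hn, Option.map_some]; rfl⟩)
    refine ⟨o, eventually_atTop_of_succ (ho1.mono fun n hn => ?_), fun γ hγ => ?_,
      fun hnone x hx hsat => ?_⟩
    · rw [inequalitySolutions]
      simp only [← hVdef, if_neg hV']
      exact hn
    · obtain ⟨β, hβ, hev⟩ := ho2 γ hγ
      obtain ⟨o', h1, h2, _⟩ := hstep β hβ
      obtain ⟨n, hn1, hn2⟩ := (h1.and hev).exists
      rw [hn1] at hn2
      cases o' with
      | none => simp at hn2
      | some γ' =>
        simp only [Option.map_some, Option.some.injEq] at hn2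
        rw [← satisfiesConds_normalizeConds ch (ordGE_algebraMap γ), ← hn2, map_add, map_mul]
        exact (satisfiesConds_shiftConds ch).1 (h2 γ' rfl)
    · rw [← satisfiesConds_normalizeConds ch hx] at hsat
      have hroot : gbar.eval (redAt p x) = 0 := by
        -- As c ≥ 0 after normalization, v(h(x)) > c forces v(h(x)) ≥ 1; so the linear factor at the
        -- reduction of x divides every reduction, and hence their gcd.
        rw [← IsRoot.def, ← dvd_iff_isRoot]
        refine dvd_foldr_gcd fun f hf => ?_
        obtain ⟨q, hq, rfl⟩ := List.mem_map.1 hf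
        obtain ⟨h1, _, h3⟩ := normalizeConds_spec ch hq
        rw [dvd_iff_isRoot, IsRoot.def, eval_redPoly h1 hx, redAt_eq_zero_iff (h1.eval hx)]
        refine OrdGE.mono (hsat q hq) ?_
        have := Int.floor_nonneg.2 h3
        omega
      set β := ch.rep p (redAt p x) with hβdef
      have hβ : β ∈ W := List.mem_map.2 ⟨redAt p x, by
        rw [(ch.rootOrder_spec p _).2, Multiset.mem_toFinset, mem_roots hgbar0]; exact hroot, rfl⟩
      obtain ⟨o', h1, _, h3⟩ := hstep β hβ
      obtain ⟨n, hn1, hn2⟩ := (h1.and (ho3 hnone β hβ)).exists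
      rw [hn1] at hn2
      simp only [Option.map_some, Option.some.injEq, Option.map_eq_none_iff] at hn2
      have hg := ch.gen_ne_zero p
      have hβ0 := ordGE_algebraMap (p := p) (K := K) β
      -- With β the chosen representative of the residue of x, (x - β)/π is integral and would solve
      -- the shifted conditions, which have no solution.
      refine h3 hn2 ((algebraMap R K (ch.gen p))⁻¹ * (x - algebraMap R K β)) ?_ ?_
      · rw [ordGE_mul_iff (inv_ne_zero hg), ordInt_inv hg, ch.ordInt_gen]
        refine OrdGE.mono ?_ (show _ ≤ (1 : ℤ) by norm_num)
        rw [← redAt_eq_zero_iff (hx.sub hβ0), redAt_sub hx hβ0, ch.red_rep, sub_self]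
      · rw [satisfiesConds_shiftConds, mul_inv_cancel_left₀ hg, add_sub_cancel]
        exact hsat

end Inequalities

/-! ### Local minimality and reduction to affine transformations -/

section LocalActions

variable {R : Type*} [CommRing R] [IsDedekindDomain R]
variable {K : Type*} [Field K] [Algebra R K] [IsFractionRing R K]
variable {p : HeightOneSpectrum R} {d : ℕ} {P Q : K[X] × K[X]}

lemma PolyGE.substForm {A : Matrix (Fin 2) (Fin 2) K} (hA : ∀ i j, OrdGE p 0 (A i j)) {f : K[X]}
    {k : ℤ} (hf : PolyGE p k f) : PolyGE p k (substForm d A f) := by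
  have h : ∀ i, PolyGE p 0 (C (A i 0) * X + C (A i 1)) := fun i =>
    ((polyGE_C (hA i 0)).mul_zero polyGE_X).add (polyGE_C (hA i 1))
  exact PolyGE.sum fun i _ =>
    ((polyGE_C (hf i)).mul_zero ((h 0).pow_zero i)).mul_zero ((h 1).pow_zero _)

lemma PairGE.actModel {l : K} {A : Matrix (Fin 2) (Fin 2) K} {k : ℤ} (hP : PairGE p k P)
    (hl : OrdGE p 0 l) (hA : ∀ i j, OrdGE p 0 (A i j)) : PairGE p k (actModel d l A P) := by
  have hf := hP.1.substForm (d := d) hA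
  have hg := hP.2.substForm (d := d) hA
  have hm : ∀ {a : K} {f : K[X]}, OrdGE p 0 a → PolyGE p k f → PolyGE p k (C a * f) := by
    intro a f ha hf
    rw [mul_comm]
    exact hf.mul_zero (polyGE_C ha)
  refine ⟨hm hl ((hm (hA 1 1) hf).sub (hm (hA 0 1) hg)), hm hl (PolyGE.add ?_ (hm (hA 0 0) hg))⟩
  rw [← C_neg]
  exact hm (hA 1 0).neg hf

lemma pairGE_actModel_iff {l : K} (hl : l ≠ 0) {A : Matrix (Fin 2) (Fin 2) K} {k : ℤ} :
    PairGE p k (actModel d l A P) ↔ PairGE p (k - ordInt p l) (actModel d 1 A P) := by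
  simp only [PairGE, _root_.actModel, C_1, one_mul, polyGE_C_mul_iff hl]

lemma ordInt_eq_of_sq_eq {x y : K} (h : x ^ 2 = y ^ 2) : ordInt p x = ordInt p y := by
  rcases sq_eq_sq_iff_eq_or_eq_neg.1 h with rfl | rfl
  · rfl
  · exact ordInt_neg

lemma ordInt_modelRes_actModel (hP : IsModel d P) {l : K} (hl : l ≠ 0)
    {A : Matrix (Fin 2) (Fin 2) K} (hA : A.det ≠ 0) :
    ordInt p (modelRes d (actModel d l A P)) =
      2 * d * ordInt p l + (d * d + d) * ordInt p A.det + ordInt p (modelRes d P) := by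
  rw [ordInt_eq_of_sq_eq (modelRes_actModel_sq hA hP.1 hP.2.1),
    ordInt_mul (mul_ne_zero (pow_ne_zero _ hl) (pow_ne_zero _ hA)) hP.2.2,
    ordInt_mul (pow_ne_zero _ hl) (pow_ne_zero _ hA), ordInt_pow hl, ordInt_pow hA]
  push_cast; ring

lemma PairGE.ordGE_modelRes (hP : PairGE p 0 P) : OrdGE p 0 (modelRes d P) :=
  hP.1.resultant hP.2 d d

lemma PairGE.ordInt_modelRes_nonneg (hP : PairGE p 0 P) : 0 ≤ ordInt p (modelRes d P) := by
  by_cases h : modelRes d P = 0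
  · simp [h]
  · exact hP.ordGE_modelRes.ordInt_le h

/-- The resultant of `P` has the least valuation among the models of its class that are integral
at `p`. -/
def IsMinimalAt (p : HeightOneSpectrum R) (d : ℕ) (P : K[X] × K[X]) : Prop :=
  ∀ Q, SameClass d P Q → PairGE p 0 Q → ordInt p (modelRes d P) ≤ ordInt p (modelRes d Q)

lemma det_affine (a b : K) : (!![a, b; 0, 1] : Matrix (Fin 2) (Fin 2) K).det = a := by
  simp [Matrix.det_fin_two]

variable (ch : Choices R K)

/-- Up to a change of variables over the local ring, a transformation is given by an upper
triangular matrix and powers of the uniformizer. -/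
lemma exists_affine_transformation (hP : IsModel d P) (h : SameClass d P Q) (hQ : PairGE p 0 Q) :
    ∃ (m e : ℤ) (β : K),
      PairGE p 0 (actModel d (algebraMap R K (ch.gen p) ^ m)
        !![algebraMap R K (ch.gen p) ^ e, β; 0, 1] P) ∧
      ordInt p (modelRes d (actModel d (algebraMap R K (ch.gen p) ^ m)
        !![algebraMap R K (ch.gen p) ^ e, β; 0, 1] P)) = ordInt p (modelRes d Q) := by
  have hQm := h.isModel hP
  obtain ⟨l, A, hl, hA, rfl⟩ := sameClass_iff.1 h
  -- It suffices to find U, invertible over the local ring, such that A·U is upper triangular. Then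
  -- A·U is c times a matrix with lower right entry 1, the scalar c is absorbed into l as c^(d+1),
  -- and the remaining diagonal entry and scalar agree with powers of π up to units.
  have main : ∀ U : Matrix (Fin 2) (Fin 2) K, (∀ i j, OrdGE p 0 (U i j)) → U.det ≠ 0 →
      ordInt p U.det = 0 → (A * U) 1 0 = 0 → ∃ (m e : ℤ) (β : K),
      PairGE p 0 (actModel d (algebraMap R K (ch.gen p) ^ m)
        !![algebraMap R K (ch.gen p) ^ e, β; 0, 1] P) ∧
      ordInt p (modelRes d (actModel d (algebraMap R K (ch.gen p) ^ m)
        !![algebraMap R K (ch.gen p) ^ e, β; 0, 1] P)) =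
        ordInt p (modelRes d (actModel d l A P)) := by
    intro U hU hU0 hU1 h10
    set a := (A * U) 0 0 with ha
    set b := (A * U) 0 1 with hb
    set c := (A * U) 1 1 with hc
    have hT : A * U = !![a, b; 0, c] := by rw [← h10]; exact (A * U).eta_fin_two
    have hdet : a * c ≠ 0 := by
      have := mul_ne_zero hA hU0
      rwa [← Matrix.det_mul, hT, Matrix.det_fin_two_of, mul_zero, sub_zero] at this
    have ha0 := left_ne_zero_of_mul hdet
    have hc0 := right_ne_zero_of_mul hdet
    set π := algebraMap R K (ch.gen p) with hπ
    have hac0 := div_ne_zero ha0 hc0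
    have hlc0 := mul_ne_zero hl (pow_ne_zero (d + 1) hc0)
    refine ⟨ordInt p (l * c ^ (d + 1)), ordInt p (a / c), b / c, ?_⟩
    set e := ordInt p (a / c) with he
    set m := ordInt p (l * c ^ (d + 1)) with hm
    have hπe := ch.gen_zpow_ne_zero p e
    have hπm := ch.gen_zpow_ne_zero p m
    have hu0 : π ^ e / (a / c) ≠ 0 := div_ne_zero hπe hac0
    have hw0 : π ^ m / (l * c ^ (d + 1)) ≠ 0 := div_ne_zero hπm hlc0
    have hu : ordInt p (π ^ e / (a / c)) = 0 := by
      rw [div_eq_mul_inv, ordInt_mul hπe (inv_ne_zero hac0), ordInt_inv hac0,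
        ch.ordInt_gen_zpow]; omega
    have hw : ordInt p (π ^ m / (l * c ^ (d + 1))) = 0 := by
      rw [div_eq_mul_inv, ordInt_mul hπm (inv_ne_zero hlc0), ordInt_inv hlc0,
        ch.ordInt_gen_zpow]; omega
    have key : actModel d (π ^ m) !![π ^ e, b / c; 0, 1] P =
        actModel d (π ^ m / (l * c ^ (d + 1))) (U * !![π ^ e / (a / c), 0; 0, 1])
          (actModel d l A P) := by
      have e1 : (A * U) * !![π ^ e / (a / c), 0; 0, 1] = c • !![π ^ e, b / c; 0, 1] := by
        rw [hT]
        ext i j; fin_cases i <;> fin_cases j <;> simp [Matrix.mul_apply] <;> field_simp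
      rw [actModel_actModel, ← Matrix.mul_assoc, e1, actModel_smul]
      congr 1
      field_simp
    have hD : (U * !![π ^ e / (a / c), 0; 0, 1]).det = U.det * (π ^ e / (a / c)) := by
      rw [Matrix.det_mul, det_affine]
    rw [key]
    constructor
    · refine hQ.actModel (by rw [ordGE_iff hw0, hw]) fun i j => ?_
      rw [Matrix.mul_apply]
      refine OrdGE.sum fun k _ => (hU i k).mul_zero ?_
      fin_cases k <;> fin_cases j <;> simp
      rw [ordGE_iff hu0, hu]
    · rw [ordInt_modelRes_actModel hQm hw0 (by rw [hD]; exact mul_ne_zero hU0 hu0), hD,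
        ordInt_mul hU0 hu0, hU1, hu, hw]
      simp
  have hrow : A 1 0 ≠ 0 ∨ A 1 1 ≠ 0 := by
    by_contra hh
    push Not at hh
    rw [Matrix.det_fin_two, hh.1, hh.2] at hA
    simp at hA
  -- In the bottom row one entry divides the other over the local ring. Clearing the lower left
  -- entry is then a column operation, preceded by a column swap if A 1 0 is the divisor.
  by_cases hcase : A 1 1 ≠ 0 ∧ OrdGE p 0 (A 1 0 / A 1 1)
  · refine main !![1, 0; -(A 1 0 / A 1 1), 1] ?_ (by simp) (by simp) ?_
    · intro i j
      fin_cases i <;> fin_cases j <;> simp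
      exact hcase.2.neg
    · simp [Matrix.mul_apply]
      field_simp [hcase.1]
      ring
  · have h10 : A 1 0 ≠ 0 := by
      rcases hrow with h | h
      · exact h
      · intro h0
        exact hcase ⟨h, by simp [h0]⟩
    have hint : OrdGE p 0 (A 1 1 / A 1 0) := by
      by_cases h11 : A 1 1 = 0
      · simp [h11]
      · have h1 : ¬ OrdGE p 0 (A 1 0 / A 1 1) := fun h => hcase ⟨h11, h⟩
        rw [ordGE_iff (div_ne_zero h10 h11)] at h1
        rw [ordGE_iff (div_ne_zero h11 h10), ← inv_div, ordInt_inv (div_ne_zero h10 h11)]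
        omega
    refine main !![-(A 1 1 / A 1 0), 1; 1, 0] ?_ (by simp) ?_ ?_
    · intro i j
      fin_cases i <;> fin_cases j <;> simp
      exact hint.neg
    · rw [Matrix.det_fin_two_of, mul_zero, zero_sub, one_mul, ordInt_neg, ordInt_one]
    · simp [Matrix.mul_apply]
      field_simp
      ring

/-- If no substitution `z ↦ π^e z + β` raises the valuation of the coefficients above
`(d + 1) / 2 * e`, then the model is minimal at `p`. -/
lemma isMinimalAt_of_forall (hd : 2 ≤ d) (hP : IsModel d P)
    (h : ∀ (e : ℤ) (β : K), ¬ PairGE p (⌊((d : ℝ) + 1) / 2 * e⌋ + 1)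
      (actModel d 1 !![algebraMap R K (ch.gen p) ^ e, β; 0, 1] P)) : IsMinimalAt p d P := by
  intro Q hPQ hQ
  obtain ⟨m, e, β, h1, h2⟩ := exists_affine_transformation ch hP hPQ hQ
  rw [← h2]
  have hm := ch.gen_zpow_ne_zero p m
  have he := ch.gen_zpow_ne_zero p e
  rw [ordInt_modelRes_actModel hP hm (by rwa [det_affine]), det_affine, ch.ordInt_gen_zpow,
    ch.ordInt_gen_zpow]
  -- A drop of the resultant means d(2m + (d+1)e) < 0, so -m > (d+1)e/2, while integrality after
  -- multiplication by π^m means that the unscaled coefficients have valuation at least -m.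
  by_contra hlt
  rw [pairGE_actModel_iff hm, ch.ordInt_gen_zpow] at h1
  refine h e β ⟨h1.1.mono ?_, h1.2.mono ?_⟩ <;>
  · rw [Int.add_one_le_iff, Int.floor_lt]
    have h3 : (d : ℤ) * (2 * m + (d + 1) * e) < 0 := by linarith
    have h4 : 2 * m + (d + 1) * e < 0 := by
      by_contra h5
      exact absurd h3 (not_lt.2 (mul_nonneg (by positivity) (not_lt.1 h5)))
    have h5 : (2 * m + (d + 1) * e : ℝ) < 0 := by exact_mod_cast h4
    push_cast
    linarith

end LocalActions

/-! ### Normalizing the content of a model -/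

section Scaling

variable {R : Type*} [CommRing R] [IsDedekindDomain R]
variable {K : Type*} [Field K] [Algebra R K] [IsFractionRing R K]
variable {p : HeightOneSpectrum R} {d : ℕ}

/-- The least valuation of a coefficient of a pair (`0` for the zero pair). -/
noncomputable def pairOrd (p : HeightOneSpectrum R) (P : K[X] × K[X]) : ℤ :=
  (min (polyOrd p P.1) (polyOrd p P.2)).untopD 0

lemma IsModel.ne_zero {P : K[X] × K[X]} (hd : 2 ≤ d) (hP : IsModel d P) : P.1 ≠ 0 := by
  intro h
  apply hP.2.2
  rw [modelRes, h, resultant_zero_left, zero_pow (by omega), zero_mul]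

lemma pairGE_iff_le {P : K[X] × K[X]} (hP : P.1 ≠ 0) {k : ℤ} :
    PairGE p k P ↔ k ≤ pairOrd p P := by
  rw [PairGE, polyGE_iff, polyGE_iff, ← le_min_iff, pairOrd]
  have : min (polyOrd p P.1) (polyOrd p P.2) ≠ ⊤ := by
    rw [polyOrd_eq_coe hP]
    exact ((min_le_left _ _).trans_lt (WithTop.coe_lt_top _)).ne
  lift min (polyOrd p P.1) (polyOrd p P.2) to ℤ using this with m
  rw [WithTop.coe_le_coe]
  rfl

variable (ch : Choices R K) {s : LocalState K}

lemma scale_model (hs : IsModel d s.model) :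
    (s.scale p (ch.gen p)).model =
      actModel d (algebraMap R K (ch.gen p) ^ (-pairOrd p s.model)) 1 s.model := by
  rw [actModel_scalar _ hs.1 hs.2.1]
  rfl

lemma isModel_scale (hs : IsModel d s.model) : IsModel d (s.scale p (ch.gen p)).model := by
  rw [scale_model ch hs]
  exact hs.actModel (ch.gen_zpow_ne_zero p _) (by simp)

lemma ordInt_modelRes_scale (hs : IsModel d s.model) :
    ordInt p (modelRes d (s.scale p (ch.gen p)).model) =
      ordInt p (modelRes d s.model) - 2 * d * pairOrd p s.model := by
  rw [scale_model ch hs, ordInt_modelRes_actModel hs (ch.gen_zpow_ne_zero p _) (by simp),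
    ch.ordInt_gen_zpow]
  simp
  ring

lemma pairGE_scale (hd : 2 ≤ d) (hs : IsModel d s.model) :
    PairGE p 0 (s.scale p (ch.gen p)).model := by
  have h1 : actModel d 1 1 s.model = s.model := by
    rw [actModel_scalar _ hs.1 hs.2.1]; simp
  rw [scale_model ch hs, pairGE_actModel_iff (ch.gen_zpow_ne_zero p _), ch.ordInt_gen_zpow, h1,
    pairGE_iff_le (hs.ne_zero hd)]
  omega

/-- Equality of whole states, recorded exponents included, is what an unchanged output for minimal
input requires. -/
lemma scale_eq_self (h : pairOrd p s.model = 0) : s.scale p (ch.gen p) = s := by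
  have e : -(min (polyOrd p s.model.1) (polyOrd p s.model.2)).untopD 0 = 0 := by
    rw [neg_eq_zero]; exact h
  simp only [LocalState.scale, e, zpow_zero, C_1, one_mul, add_zero]

end Scaling

/-! ### The conditions on the translation parameter -/

section ReductionConditions

variable {R : Type*} [CommRing R] [IsDedekindDomain R]
variable {K : Type*} [Field K] [Algebra R K] [IsFractionRing R K]
variable {p : HeightOneSpectrum R} {d : ℕ} {P : K[X] × K[X]}

open Filter

lemma eval_fCoeffPoly (h1 : P.1.natDegree ≤ d) (h2 : P.2.natDegree ≤ d) (π : K) (e : ℤ) (β : K)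
    (j : ℕ) : (fCoeffPoly d π e P j).eval β = (actModel d 1 !![π ^ e, β; 0, 1] P).1.coeff j := by
  rw [actModel_affine _ _ _ h1 h2]
  dsimp only
  rw [C_1, one_mul, coeff_sub, coeff_C_mul, coeff_comp_affine _ _ h1,
    coeff_comp_affine _ _ h2, fCoeffPoly, eval_mul, eval_C, eval_finsetSum, mul_comm (j : ℤ) e,
    zpow_mul, zpow_natCast, mul_left_comm, ← mul_sub]
  congr 1
  rw [Finset.mul_sum, ← Finset.sum_sub_distrib]
  refine Finset.sum_congr rfl fun i _ => ?_
  simp only [eval_mul, eval_sub, eval_C, eval_pow, eval_X, pow_succ]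
  ring

lemma eval_gCoeffPoly (h1 : P.1.natDegree ≤ d) (h2 : P.2.natDegree ≤ d) {π : K} (hπ : π ≠ 0)
    (e : ℤ) (β : K) (j : ℕ) :
    (gCoeffPoly d π e P j).eval β = (actModel d 1 !![π ^ e, β; 0, 1] P).2.coeff j := by
  rw [actModel_affine _ _ _ h1 h2]
  dsimp only
  rw [C_1, one_mul, coeff_C_mul, coeff_comp_affine _ _ h2,
    gCoeffPoly, eval_mul, eval_C, eval_finsetSum, add_mul, one_mul, zpow_add₀ hπ,
    mul_comm (j : ℤ) e, zpow_mul, zpow_natCast, mul_comm ((π ^ e) ^ j), mul_assoc]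
  congr 2
  refine Finset.sum_congr rfl fun i _ => ?_
  simp only [eval_mul, eval_C, eval_pow, eval_X]

variable (ch : Choices R K)

lemma satisfiesConds_reductionConds (h1 : P.1.natDegree ≤ d) (h2 : P.2.natDegree ≤ d) (e : ℤ)
    (β : K) : SatisfiesConds p (reductionConds d p (ch.gen p) e P) β ↔
      PairGE p (⌊((d : ℝ) + 1) / 2 * e⌋ + 1)
        (actModel d 1 !![algebraMap R K (ch.gen p) ^ e, β; 0, 1] P) := by
  have key : ∀ q : K[X] × ℝ, OrdGT p (clearDenoms p (ch.gen p) q).2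
      ((clearDenoms p (ch.gen p) q).1.eval β) ↔ OrdGT p q.2 (q.1.eval β) := by
    intro q
    rw [clearDenoms, eval_mul, eval_C, ordGT_mul_iff (ch.gen_zpow_ne_zero p _),
      ch.ordInt_gen_zpow, add_sub_cancel_right]
  have hc : ∀ (f : K[X]) (k : ℤ), f.natDegree ≤ d →
      (PolyGE p k f ↔ ∀ j < d + 1, OrdGE p k (f.coeff j)) := by
    intro f k hf
    refine ⟨fun h j _ => h j, fun h j => ?_⟩
    by_cases hj : j < d + 1
    · exact h j hj
    · rw [coeff_eq_zero_of_natDegree_lt (by omega)]; simp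
  simp only [SatisfiesConds, reductionConds, List.forall_mem_map, key, List.forall_mem_append,
    List.mem_range, eval_fCoeffPoly h1 h2, eval_gCoeffPoly h1 h2 (ch.gen_ne_zero p), PairGE,
    hc _ _ (natDegree_actModel_fst_le _ _ _), hc _ _ (natDegree_actModel_snd_le _ _ _)]
  rfl

lemma polyGE_of_mem_reductionConds {e : ℤ} {q : K[X] × ℝ}
    (hq : q ∈ reductionConds d p (ch.gen p) e P) : PolyGE p 0 q.1 := by
  obtain ⟨r, _, rfl⟩ := List.mem_map.1 hq
  rw [clearDenoms, polyGE_C_mul_iff (ch.gen_zpow_ne_zero p _), ch.ordInt_gen_zpow]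
  exact (polyGE_polyOrdInt r.1).mono (by have := le_max_right 0 (-polyOrdInt p r.1); omega)

/-- If v(x) were smaller than the bound, the leading term would have strictly smaller valuation than
every other term, so v(h(x)) = v(hₙxⁿ) by the ultrametric inequality; the first entry of the minimum
makes this less than c. -/
lemma betaBound_le {h : K[X]} {c : ℝ} (hn : 1 ≤ h.natDegree) {x : K} (hx : x ≠ 0)
    (hc : OrdGT p c (h.eval x)) : betaBound p h c ≤ ordInt p x := by
  classical
  set n := h.natDegree with hndef
  have hn0 : h.coeff n ≠ 0 := by
    rw [hndef, coeff_natDegree, Ne, leadingCoeff_eq_zero]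
    intro h0; simp [hndef, h0] at hn
  set vn : ℝ := ((ordInt p (h.coeff n) : ℤ) : ℝ) with hvn
  have hnpos : (0 : ℝ) < n := by exact_mod_cast hn
  set m : WithTop ℝ := min ((((c - vn) / n : ℝ)) : WithTop ℝ)
    ((h.support.erase n).inf fun i =>
      (((((ordInt p (h.coeff i) : ℝ) - vn) / ((n : ℝ) - i) : ℝ)) : WithTop ℝ)) with hm
  have hb : betaBound p h c = m.untopD 0 := rfl
  have hmtop : m ≠ ⊤ := ((min_le_left _ _).trans_lt (WithTop.coe_lt_top _)).ne
  have hmb : m = (betaBound p h c : WithTop ℝ) := by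
    rw [hb]
    lift m to ℝ using hmtop with r
    rfl
  by_contra hlt
  rw [not_le, ← WithTop.coe_lt_coe, ← hmb, hm, lt_min_iff, Finset.lt_inf_iff (WithTop.coe_lt_top _)]
    at hlt
  obtain ⟨hlt1, hlt2⟩ := hlt
  rw [WithTop.coe_lt_coe, lt_div_iff₀ hnpos] at hlt1
  have hxn : ordInt p (h.coeff n * x ^ n) = ordInt p (h.coeff n) + n * ordInt p x := by
    rw [ordInt_mul hn0 (pow_ne_zero _ hx), ordInt_pow hx]
  have hlow : OrdGE p (ordInt p (h.coeff n * x ^ n) + 1)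
      (∑ i ∈ Finset.range n, h.coeff i * x ^ i) := by
    refine OrdGE.sum fun i hi => ?_
    by_cases hi0 : h.coeff i = 0
    · simp [hi0]
    have hin : i < n := Finset.mem_range.1 hi
    have h3 := hlt2 i (Finset.mem_erase.2 ⟨hin.ne, mem_support_iff.2 hi0⟩)
    have hin' : (0 : ℝ) < (n : ℝ) - i := by
      have : (i : ℝ) < n := by exact_mod_cast hin
      linarith
    rw [WithTop.coe_lt_coe, lt_div_iff₀ hin'] at h3
    rw [ordGE_iff (mul_ne_zero hi0 (pow_ne_zero _ hx)), hxn, ordInt_mul hi0 (pow_ne_zero _ hx),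
      ordInt_pow hx, Int.add_one_le_iff]
    have h4 : (ordInt p (h.coeff n) + n * ordInt p x : ℝ) <
        ordInt p (h.coeff i) + i * ordInt p x := by
      rw [hvn] at h3; nlinarith
    exact_mod_cast h4
  have hle : ¬ OrdGE p (ordInt p (h.coeff n * x ^ n) + 1) (h.eval x) := by
    intro h5
    rw [eval_eq_sum_range, ← hndef, Finset.sum_range_succ] at h5
    have h6 := h5.sub hlow
    rw [add_sub_cancel_left, ordGE_iff (mul_ne_zero hn0 (pow_ne_zero _ hx))] at h6
    omega
  refine hle (OrdGE.mono hc ?_)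
  have h7 : (((ordInt p (h.coeff n * x ^ n) : ℤ)) : ℝ) < c := by
    rw [hxn]; push_cast; rw [hvn] at hlt1; linarith
  have := Int.le_floor.2 h7.le
  omega

lemma ordGE_neg_denomExp {V : List (K[X] × ℝ)} {x : K} (hV : ∃ q ∈ V, 1 ≤ q.1.natDegree)
    (hx : SatisfiesConds p V x) : OrdGE p (-denomExp p V) x := by
  classical
  by_cases hx0 : x = 0
  · simp [hx0]
  rw [ordGE_iff hx0, denomExp, neg_neg, Int.ceil_le]
  set L := ((V.filter fun q => decide (1 ≤ q.1.natDegree)).map fun q =>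
      betaBound p q.1 q.2) with hL
  have hmem : ∀ b ∈ L, b ≤ ordInt p x := by
    intro b hb
    obtain ⟨q, hq, rfl⟩ := List.mem_map.1 hb
    rw [List.mem_filter, decide_eq_true_eq] at hq
    exact betaBound_le hq.2 hx0 (hx q hq.1)
  obtain ⟨q, hq, hq1⟩ := hV
  have hne : L.maximum ≠ ⊥ := by
    rw [Ne, List.maximum_eq_bot]
    exact List.ne_nil_of_mem (List.mem_map.2 ⟨q, List.mem_filter.2 ⟨hq, by simpa using hq1⟩, rfl⟩)
  obtain ⟨b, hb⟩ := WithBot.ne_bot_iff_exists.1 hne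
  have e : L.maximum.unbotD 0 = b := by rw [← hb]; rfl
  exact le_of_eq_of_le e (hmem b (List.maximum_mem hb.symm))

lemma satisfiesConds_rescaleConds (B : ℤ) (V : List (K[X] × ℝ)) (y : K) :
    SatisfiesConds p (rescaleConds (ch.gen p) B V) y ↔
      SatisfiesConds p V (algebraMap R K (ch.gen p) ^ (-B) * y) := by
  simp only [SatisfiesConds, rescaleConds, List.forall_mem_map]
  refine forall₂_congr fun q _ => ?_
  split_ifs with hB
  · rw [eval_mul, eval_C, ordGT_mul_iff (ch.gen_zpow_ne_zero p _), ch.ordInt_gen_zpow, eval_comp]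
    push_cast
    simp
  · simp [eval_comp]

/-- For B > 0 the coefficient hᵢ is multiplied by π^((n-i)B) with i ≤ n, and for B ≤ 0 by π^(-iB);
both exponents are nonnegative. -/
lemma polyGE_of_mem_rescaleConds {B : ℤ} {V : List (K[X] × ℝ)} (hV : ∀ q ∈ V, PolyGE p 0 q.1)
    {q : K[X] × ℝ} (hq : q ∈ rescaleConds (ch.gen p) B V) : PolyGE p 0 q.1 := by
  obtain ⟨r, hr, rfl⟩ := List.mem_map.1 hq
  have h0 := hV r hr
  have hB0 := ch.gen_zpow_ne_zero p (-B)
  split_ifs with hB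
  · intro i
    rw [coeff_C_mul, coeff_comp_C_mul_X', ordGE_mul_iff (ch.gen_zpow_ne_zero p _),
      ch.ordInt_gen_zpow, mul_comm (r.1.coeff i), ordGE_mul_iff (pow_ne_zero _ hB0), ordInt_pow hB0,
      ch.ordInt_gen_zpow]
    by_cases hi : i ≤ r.1.natDegree
    · refine (h0 i).mono ?_
      have : (i : ℤ) * B ≤ r.1.natDegree * B :=
        mul_le_mul_of_nonneg_right (by exact_mod_cast hi) hB.le
      linarith
    · rw [coeff_eq_zero_of_natDegree_lt (by omega)]; simp
  · refine h0.comp (PolyGE.mul_zero (polyGE_C ?_) polyGE_X)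
    rw [ordGE_iff hB0, ch.ordInt_gen_zpow]; omega

lemma exists_nat_forall_lt (V : List (K[X] × ℝ)) : ∃ M : ℕ, ∀ q ∈ V, q.2 < M := by
  induction V with
  | nil => exact ⟨0, by simp⟩
  | cons a V ih =>
    obtain ⟨M, hM⟩ := ih
    obtain ⟨N, hN⟩ := exists_nat_gt a.2
    refine ⟨max M N, fun q hq => ?_⟩
    push_cast
    rcases List.mem_cons.1 hq with rfl | hq
    · exact lt_max_of_lt_right hN
    · exact lt_max_of_lt_left (hM q hq)

/-- Every solution in K has denominator at most π^B, so the integral search for π^B·β is exhaustive.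
A solution found is π^(-B) times an element of R, hence integral away from p; this protects the
other primes. -/
theorem findBeta_spec (hP : IsModel d P) (e : ℤ) :
    ∃ o : Option (ℤ × K), (∀ᶠ n in atTop, findBeta ch p n d P e = some o) ∧
      (∀ c, o = some c → c.1 = e ∧ (∀ q : HeightOneSpectrum R, q ≠ p → OrdGE q 0 c.2) ∧
        PairGE p (⌊((d : ℝ) + 1) / 2 * e⌋ + 1)
          (actModel d 1 !![algebraMap R K (ch.gen p) ^ e, c.2; 0, 1] P)) ∧
      (o = none → ∀ β, ¬ PairGE p (⌊((d : ℝ) + 1) / 2 * e⌋ + 1)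
          (actModel d 1 !![algebraMap R K (ch.gen p) ^ e, β; 0, 1] P)) := by
  set V' := reductionConds d p (ch.gen p) e P with hV'
  set B := denomExp p V' with hB
  set V := rescaleConds (ch.gen p) B V' with hVdef
  obtain ⟨M, hM⟩ := exists_nat_forall_lt V
  obtain ⟨o, h1, h2, h3⟩ := inequalitySolutions_spec ch (p := p) M V
    (fun q hq => polyGE_of_mem_rescaleConds ch
      (fun r hr => polyGE_of_mem_reductionConds ch hr) hq) hM
  have hsat := satisfiesConds_reductionConds ch (p := p) hP.1 hP.2.1 e
  refine ⟨o.map fun β' => (e, (algebraMap R K (ch.gen p)) ^ (-B) * algebraMap R K β'),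
    h1.mono fun n hn => ?_, fun c hc => ?_, fun hnone β hβ => ?_⟩
  · simp only [findBeta, ← hV', ← hB, ← hVdef, hn, Option.map_some]
  · obtain ⟨β', rfl, rfl⟩ := Option.map_eq_some_iff.1 hc
    refine ⟨rfl, fun q hq => OrdGE.mul_zero ?_ (ordGE_algebraMap _), ?_⟩
    · rw [ordGE_iff (ch.gen_zpow_ne_zero p _), ordInt_zpow (ch.gen_ne_zero p),
        ordInt_of_span_singleton_ne hq.symm (ch.span_gen p), mul_zero]
    · rw [← hsat, ← hV', ← satisfiesConds_rescaleConds]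
      exact h2 β' rfl
  · rw [Option.map_eq_none_iff] at hnone
    rw [← hsat, ← hV'] at hβ
    by_cases hdeg : ∃ q ∈ V', 1 ≤ q.1.natDegree
    · refine h3 hnone (algebraMap R K (ch.gen p) ^ B * β) ?_ ?_
      · rw [ordGE_mul_iff (ch.gen_zpow_ne_zero p _), ch.ordInt_gen_zpow, zero_sub]
        exact ordGE_neg_denomExp hdeg hβ
      · rw [hVdef, satisfiesConds_rescaleConds, ← mul_assoc, ← zpow_add₀ (ch.gen_ne_zero p)]
        simpa using hβ
    -- With constant polynomials only, no bound on β exists, but then the conditions do not depend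
    -- on β and 0 satisfies them as well.
    · refine h3 hnone 0 ordGE_zero ?_
      rw [hVdef, satisfiesConds_rescaleConds]
      intro q hq
      have hq0 : q.1.natDegree = 0 := by
        by_contra h; exact hdeg ⟨q, hq, by omega⟩
      have := hβ q hq
      rw [eq_C_of_natDegree_eq_zero hq0, eval_C] at this ⊢
      exact this

end ReductionConditions

/-! ### Finiteness of the range of exponents -/

section ExponentRange

variable {R : Type*} [CommRing R] [IsDedekindDomain R]
variable {K : Type*} [Field K] [Algebra R K] [IsFractionRing R K]
variable {p : HeightOneSpectrum R} {d : ℕ} {P : K[X] × K[X]}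

/-- Over the local ring the resultant is a combination fu + gw; evaluating at x gives the bound. -/
lemma ordGE_resultant_of_integral {f g : K[X]} {m n : ℕ} {k : ℤ} {x : K} (hf : PolyGE p 0 f)
    (hg : PolyGE p 0 g) (hm : f.natDegree ≤ m) (hn : g.natDegree ≤ n) (hmn : m ≠ 0 ∨ n ≠ 0)
    (hx : OrdGE p 0 x) (hfx : OrdGE p k (f.eval x)) (hgx : OrdGE p k (g.eval x)) :
    OrdGE p k (resultant f g m n) := by
  obtain ⟨F, rfl⟩ := hf.exists_map
  obtain ⟨G, rfl⟩ := hg.exists_map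
  have hinj : Function.Injective
      (algebraMap (HeightOneSpectrum.valuationSubringAtPrime K p) K) := Subtype.val_injective
  rw [natDegree_map_eq_of_injective hinj] at hm hn
  obtain ⟨u, w, -, -, h⟩ := exists_mul_add_mul_eq_C_resultant F G hm hn hmn
  have h' := congrArg (fun q => (q.map (algebraMap _ K)).eval x) h
  simp only [Polynomial.map_add, Polynomial.map_mul, eval_add, eval_mul, map_C, eval_C] at h'
  rw [resultant_map_map, ← h']
  have hint : ∀ q : (HeightOneSpectrum.valuationSubringAtPrime K p)[X],
      OrdGE p 0 ((q.map (algebraMap _ K)).eval x) := fun q =>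
    PolyGE.eval (fun i => by rw [coeff_map]; exact mem_valuationSubringAtPrime.1 (Subtype.property _))
      hx
  exact (hfx.mul_zero (hint u)).add (hgx.mul_zero (hint w))

lemma eval_reflect_inv {f : K[X]} {m : ℕ} (hm : f.natDegree ≤ m) {x : K} (hx : x ≠ 0) :
    (reflect m f).eval x⁻¹ = f.eval x * x⁻¹ ^ m := by
  let _ := invertibleOfNonzero hx
  have := eval₂_reflect_mul_pow (RingHom.id K) x m f hm
  rw [invOf_eq_inv] at this
  simp only [eval₂_id] at this
  rw [← this, inv_pow, mul_assoc, mul_inv_cancel₀ (pow_ne_zero _ hx), mul_one]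

/-- A common approximate root of two integral polynomials bounds the valuation of their
resultant from below. -/
lemma ordGE_resultant {f g : K[X]} {m n : ℕ} {k : ℤ} (x : K) (hf : PolyGE p 0 f)
    (hg : PolyGE p 0 g) (hm : f.natDegree ≤ m) (hn : g.natDegree ≤ n) (hmn : m ≠ 0 ∨ n ≠ 0)
    (hfx : OrdGE p k (f.eval x)) (hgx : OrdGE p k (g.eval x)) :
    OrdGE p k (resultant f g m n) := by
  by_cases hx : OrdGE p 0 x
  · exact ordGE_resultant_of_integral hf hg hm hn hmn hx hfx hgx
  have hx0 : x ≠ 0 := by rintro rfl; simp at hx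
  have hxi : OrdGE p 0 x⁻¹ := by
    rw [ordGE_iff hx0] at hx
    rw [ordGE_iff (inv_ne_zero hx0), ordInt_inv hx0]; omega
  have hr : ∀ {q : K[X]} {r : ℕ}, PolyGE p 0 q → PolyGE p 0 (reflect r q) := fun hq i => by
    rw [coeff_reflect]; exact hq _
  have hdeg : ∀ {q : K[X]} {r : ℕ}, q.natDegree ≤ r → (reflect r q).natDegree ≤ r := by
    intro q r hq
    rw [natDegree_le_iff_coeff_eq_zero]
    intro i hi
    rw [coeff_reflect, revAt_eq_self_of_lt hi, coeff_eq_zero_of_natDegree_lt (by omega)]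
  -- If x is not integral, 1/x is. The reversed polynomials at 1/x take the values f(x)x^(-m) and
  -- g(x)x^(-n), at least as divisible as f(x) and g(x), and reversal changes the resultant only by
  -- a sign.
  have key := ordGE_resultant_of_integral (m := m) (n := n) (k := k) (hr hf) (hr hg) (hdeg hm)
    (hdeg hn) hmn hxi
    (by rw [eval_reflect_inv hm hx0]; exact hfx.mul_zero (hxi.pow_zero _))
    (by rw [eval_reflect_inv hn hx0]; exact hgx.mul_zero (hxi.pow_zero _))
  rcases sq_eq_sq_iff_eq_or_eq_neg.1 (resultant_reflect_sq f g m n) with h | h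
  · rwa [h] at key
  · rw [h] at key; simpa using key.neg

lemma IsModel.isCoprime (hd : 2 ≤ d) (hP : IsModel d P) : IsCoprime P.1 P.2 := by
  obtain ⟨u, w, -, -, h⟩ := exists_mul_add_mul_eq_C_resultant P.1 P.2 hP.1 hP.2.1
    (Or.inl (by omega))
  have hr : resultant P.1 P.2 d d ≠ 0 := hP.2.2
  refine ⟨C (resultant P.1 P.2 d d)⁻¹ * u, C (resultant P.1 P.2 d d)⁻¹ * w, ?_⟩
  calc _ = C (resultant P.1 P.2 d d)⁻¹ * (P.1 * u + P.2 * w) := by ring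
    _ = 1 := by rw [h, ← C_mul, inv_mul_cancel₀ hr, C_1]

variable (ch : Choices R K)

/-- The three bounds come from the leading coefficient of g, the coefficient of z^d in the
transformed f, and the two constant coefficients. Failure for all e in the range therefore means
failure for every integer e. -/
lemma mem_e₂Range (hd : 2 ≤ d) (hP : IsModel d P) (hint : PairGE p 0 P) {e : ℤ} {β : K}
    (h : PairGE p (⌊((d : ℝ) + 1) / 2 * e⌋ + 1)
      (actModel d 1 !![algebraMap R K (ch.gen p) ^ e, β; 0, 1] P)) : e ∈ e₂Range d p P := by
  have hd' : (2 : ℝ) ≤ d := by exact_mod_cast hd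
  have hd1 : (0 : ℝ) < (d : ℝ) - 1 := by linarith
  have hπ := ch.gen_ne_zero p
  have hπe := ch.gen_zpow_ne_zero p e
  rw [actModel_affine _ _ _ hP.1 hP.2.1, C_1, one_mul, one_mul] at h
  set a := algebraMap R K (ch.gen p) ^ e with ha
  have hae : ordInt p a = e := ch.ordInt_gen_zpow p e
  obtain ⟨hf, hg⟩ := h
  replace hf : ∀ j, OrdGT p (((d : ℝ) + 1) / 2 * e) _ := hf
  replace hg : ∀ j, OrdGT p (((d : ℝ) + 1) / 2 * e) _ := hg
  have hcop := hP.isCoprime hd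
  have hg0 : P.2 ≠ 0 := by
    intro h0
    apply hP.2.2
    rw [modelRes, h0, resultant_zero_right, zero_pow (by omega), zero_mul]
  set dG := P.2.natDegree with hdG
  -- The coefficient of z^dG in the second polynomial is π^((dG+1)e) times the leading coefficient
  -- of g; comparing with (d+1)e/2 leaves the positive factor (2dG - d + 1)/2 on e.
  have hL1 : d + 1 < 2 * dG →
      -(2 / (2 * (dG : ℝ) - d + 1)) * ordInt p (P.2.coeff dG) < e := by
    intro hlt
    have hlt' : (d : ℝ) + 1 < 2 * dG := by exact_mod_cast hlt
    have hlc : P.2.coeff dG ≠ 0 := leadingCoeff_ne_zero.2 hg0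
    have h1 := hg dG
    rw [coeff_C_mul, coeff_comp_affine_natDegree _ hdG.ge, ← mul_assoc, ← pow_succ',
      ordGT_iff (mul_ne_zero (pow_ne_zero _ hπe) hlc), ordInt_mul (pow_ne_zero _ hπe) hlc,
      ordInt_pow hπe, hae] at h1
    push_cast at h1
    rw [neg_mul, div_mul_eq_mul_div, ← neg_div, div_lt_iff₀ (by linarith)]
    linarith
  -- Here f has degree d, since otherwise the resultant vanishes, and g does not contribute to the
  -- coefficient π^(de)·f_d of z^d.
  have hL2 : dG < d → -(2 / ((d : ℝ) - 1)) * ordInt p (P.1.coeff d) < e := by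
    intro hlt
    have hfd : P.1.coeff d ≠ 0 := by
      intro h0
      apply hP.2.2
      refine resultant_eq_zero_of_lt_lt _ _ _ _ (lt_of_le_of_ne hP.1 ?_) hlt
      intro h1
      rw [← h1, coeff_natDegree, leadingCoeff_eq_zero] at h0
      exact hP.ne_zero hd h0
    have h1 := hf d
    rw [coeff_sub, coeff_C_mul, coeff_comp_affine_natDegree _ hP.1,
      coeff_comp_affine_natDegree _ hP.2.1, coeff_eq_zero_of_natDegree_lt hlt, mul_zero, mul_zero,
      sub_zero, ordGT_iff (mul_ne_zero (pow_ne_zero _ hπe) hfd), ordInt_mul (pow_ne_zero _ hπe) hfd,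
      ordInt_pow hπe, hae] at h1
    push_cast at h1
    rw [neg_mul, div_mul_eq_mul_div, ← neg_div, div_lt_iff₀ hd1]
    linarith
  have hres0 : resultant (P.1 - X * P.2) P.2 ≠ 0 := by
    refine resultant_ne_zero _ _ ?_
    have : P.1 - X * P.2 = P.1 + (-X) * P.2 := by ring
    rw [this]
    exact hcop.add_mul_right_left (-X)
  have hintH : PolyGE p 0 (P.1 - X * P.2) := hint.1.sub (polyGE_X.mul_zero hint.2)
  -- For e ≥ 0 both f(β) - βg(β) and g(β) have valuation above (d-1)e/2, the second having lost e
  -- from its factor π^e; so the resultant of f - zg and g does too. For e < 0 integrality of this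
  -- resultant suffices.
  have hU : (e : ℝ) < 2 / ((d : ℝ) - 1) * ordInt p (resultant (P.1 - X * P.2) P.2) := by
    rw [div_mul_eq_mul_div, lt_div_iff₀ hd1]
    by_cases he : 0 ≤ e
    · have he' : (0 : ℝ) ≤ e := by exact_mod_cast he
      have h1 := hf 0
      have h2 := hg 0
      rw [coeff_C_mul, ordGT_mul_iff hπe, hae, coeff_zero_eq_eval_zero, eval_comp] at h2
      rw [coeff_zero_eq_eval_zero, eval_sub, eval_mul, eval_comp, eval_comp, eval_C] at h1
      simp only [eval_add, eval_mul, eval_C, eval_X, mul_zero, zero_add] at h1 h2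
      have h3 : OrdGT p (((d : ℝ) - 1) / 2 * e) (resultant (P.1 - X * P.2) P.2) := by
        refine ordGE_resultant β hintH hint.2 le_rfl le_rfl ?_ ?_ ?_
        · by_contra hdeg
          push Not at hdeg
          apply hP.2.2
          refine resultant_eq_zero_of_lt_lt _ _ _ _ ?_ (by omega)
          have e1 : P.1 = (P.1 - X * P.2) + X * P.2 := by ring
          rw [e1]
          refine lt_of_le_of_lt (natDegree_add_le_of_degree_le (n := 1) (by omega) ?_) (by omega)
          refine natDegree_mul_le.trans ?_
          rw [natDegree_X]; omega
        · rw [eval_sub, eval_mul, eval_X]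
          refine OrdGE.mono h1 ?_
          have := Int.floor_le_floor
            (show ((d : ℝ) - 1) / 2 * e ≤ ((d : ℝ) + 1) / 2 * e by nlinarith)
          omega
        · have e2 : ((d : ℝ) - 1) / 2 * e = ((d : ℝ) + 1) / 2 * e - e := by ring
          rw [e2]
          exact h2
      rw [ordGT_iff hres0] at h3
      linarith
    · have he' : (e : ℝ) < 0 := by exact_mod_cast not_le.1 he
      have h4 : (0 : ℝ) ≤ ordInt p (resultant (P.1 - X * P.2) P.2) := by
        exact_mod_cast (hintH.resultant hint.2 _ _).ordInt_le hres0
      nlinarith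
  rw [e₂Range, Finset.mem_Ioo, Int.floor_lt, Int.lt_ceil]
  refine ⟨?_, hU⟩
  simp only [← hdG]
  split_ifs with c1 c2
  · exact max_lt (hL1 c2) (hL2 c1)
  · exact hL2 c1
  -- When dG = d, the first lower bound applies because d + 1 < 2d, or d + 1 = 2d would give d = 1.
  · have : dG = d := le_antisymm hP.2.1 (not_lt.1 c1)
    exact hL1 (by omega)

end ExponentRange

/-! ### Termination and minimality at one prime -/

section LocalLoop

variable {R : Type*} [CommRing R] [IsDedekindDomain R]
variable {K : Type*} [Field K] [Algebra R K] [IsFractionRing R K]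
variable {p : HeightOneSpectrum R} {d : ℕ} {P : K[X] × K[X]}

open Filter

lemma affine_mul_affine (a b a' b' : K) :
    (!![a, b; 0, 1] * !![a', b'; 0, 1] : Matrix (Fin 2) (Fin 2) K) =
      !![a * a', b + a * b'; 0, 1] := by
  ext i j; fin_cases i <;> fin_cases j <;> simp [Matrix.mul_apply, add_comm]

/-- The model of the state is obtained from `P` by the recorded transformation. -/
def LocalState.IsTransformOf (d : ℕ) (π : K) (P : K[X] × K[X]) (s : LocalState K) : Prop :=
  s.model = actModel d (π ^ s.e₁) !![π ^ s.e₂, s.β; 0, 1] P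

variable (ch : Choices R K) {s : LocalState K}

lemma LocalState.IsTransformOf.scale (hs : IsModel d s.model)
    (h : s.IsTransformOf d (algebraMap R K (ch.gen p)) P) :
    (s.scale p (ch.gen p)).IsTransformOf d (algebraMap R K (ch.gen p)) P := by
  rw [LocalState.IsTransformOf, scale_model ch hs, h, actModel_actModel, mul_one,
    ← zpow_add₀ (ch.gen_ne_zero p), ← h, add_comm]
  rfl

lemma move_model (hs : IsModel d s.model) (e : ℤ) (β : K) :
    (s.move (ch.gen p) e β).model =
      actModel d 1 !![algebraMap R K (ch.gen p) ^ e, β; 0, 1] s.model := by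
  rw [actModel_affine _ _ _ hs.1 hs.2.1, C_1, one_mul, one_mul]
  rfl

lemma LocalState.IsTransformOf.move (hs : IsModel d s.model) (e : ℤ) (β : K)
    (h : s.IsTransformOf d (algebraMap R K (ch.gen p)) P) :
    (s.move (ch.gen p) e β).IsTransformOf d (algebraMap R K (ch.gen p)) P := by
  rw [LocalState.IsTransformOf, move_model ch hs, h, actModel_actModel, one_mul,
    affine_mul_affine, ← zpow_add₀ (ch.gen_ne_zero p)]
  rfl

lemma ordInt_gen_zpow_of_ne {q : HeightOneSpectrum R} (hq : q ≠ p) (n : ℤ) :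
    ordInt q (algebraMap R K (ch.gen p) ^ n) = 0 := by
  rw [ordInt_zpow (ch.gen_ne_zero p), ordInt_of_span_singleton_ne hq.symm (ch.span_gen p),
    mul_zero]

lemma ordGE_gen_zpow_of_ne {q : HeightOneSpectrum R} (hq : q ≠ p) (n : ℤ) :
    OrdGE q 0 (algebraMap R K (ch.gen p) ^ n) := by
  rw [ordGE_iff (ch.gen_zpow_ne_zero p n), ordInt_gen_zpow_of_ne ch hq]

lemma pairGE_scale_of_ne {q : HeightOneSpectrum R} (hq : q ≠ p) (hs : IsModel d s.model)
    (h : PairGE q 0 s.model) : PairGE q 0 (s.scale p (ch.gen p)).model := by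
  rw [scale_model ch hs]
  refine h.actModel (ordGE_gen_zpow_of_ne ch hq _) fun i j => ?_
  rw [Matrix.one_apply]
  split_ifs <;> simp

lemma pairGE_move_of_ne {q : HeightOneSpectrum R} (hq : q ≠ p) (hs : IsModel d s.model)
    (h : PairGE q 0 s.model) (e : ℤ) {β : K} (hβ : OrdGE q 0 β) :
    PairGE q 0 (s.move (ch.gen p) e β).model := by
  rw [move_model ch hs]
  refine h.actModel ordGE_one fun i j => ?_
  fin_cases i <;> fin_cases j <;> simp [hβ, ordGE_gen_zpow_of_ne ch hq]

/-- A successful step lowers the valuation of the resultant. -/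
lemma ordInt_modelRes_scale_move_lt (hd : 2 ≤ d) (hs : IsModel d s.model) {e : ℤ} {β : K}
    (h : PairGE p (⌊((d : ℝ) + 1) / 2 * e⌋ + 1)
      (actModel d 1 !![algebraMap R K (ch.gen p) ^ e, β; 0, 1] s.model)) :
    ordInt p (modelRes d ((s.move (ch.gen p) e β).scale p (ch.gen p)).model) <
      ordInt p (modelRes d s.model) := by
  have he := ch.gen_zpow_ne_zero p e
  have hm : IsModel d (s.move (ch.gen p) e β).model := by
    rw [move_model ch hs]
    exact hs.actModel one_ne_zero (by rwa [det_affine])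
  rw [ordInt_modelRes_scale ch hm]
  rw [move_model ch hs] at hm ⊢
  rw [pairGE_iff_le (hm.ne_zero hd), Int.add_one_le_iff, Int.floor_lt] at h
  rw [ordInt_modelRes_actModel hs one_ne_zero (by rwa [det_affine]), det_affine,
    ch.ordInt_gen_zpow, ordInt_one]
  set k := pairOrd p (actModel d 1 !![algebraMap R K (ch.gen p) ^ e, β; 0, 1] s.model)
  -- The move adds (d²+d)e to the valuation of the resultant and the following scaling subtracts
  -- 2dk; the condition is exactly k > (d+1)e/2.
  have h1 : ((d : ℝ) + 1) * e < 2 * k := by linarith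
  have h2 : ((d : ℤ) + 1) * e < 2 * k := by exact_mod_cast h1
  have h3 : (d : ℤ) * (((d : ℤ) + 1) * e) < d * (2 * k) :=
    mul_lt_mul_of_pos_left h2 (by omega)
  linarith

/-- Induction on a bound for the valuation of the resultant after scaling, which is nonnegative and
drops at each success. The final alternative separates a run without moves from one with a strict
drop, for use with minimal input. -/
theorem localLoop_spec (hd : 2 ≤ d) (N : ℕ) (s : LocalState K) (hs : IsModel d s.model)
    (hN : ordInt p (modelRes d (s.scale p (ch.gen p)).model) < N) :
    ∃ t : LocalState K, (∀ᶠ n in atTop, localLoop ch p d n s = some t) ∧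
      (∀ P, s.IsTransformOf d (algebraMap R K (ch.gen p)) P →
        t.IsTransformOf d (algebraMap R K (ch.gen p)) P) ∧
      PairGE p 0 t.model ∧ IsMinimalAt p d t.model ∧
      (∀ q : HeightOneSpectrum R, q ≠ p → PairGE q 0 s.model → PairGE q 0 t.model) ∧
      (t = s.scale p (ch.gen p) ∨
        ordInt p (modelRes d t.model) <
          ordInt p (modelRes d (s.scale p (ch.gen p)).model)) := by
  induction N generalizing s with
  | zero =>
    have := (pairGE_scale ch (p := p) hd hs).ordInt_modelRes_nonneg (d := d)
    simp only [CharP.cast_eq_zero] at hN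
    omega
  | succ N ih =>
    set s' := s.scale p (ch.gen p) with hs'def
    have hs' : IsModel d s'.model := isModel_scale ch hs
    have hint : PairGE p 0 s'.model := pairGE_scale ch hd hs
    obtain ⟨o, ho1, ho2, ho3⟩ := firstSuccess_spec
      (body := fun n => findBeta ch p n d s'.model)
      (l := ch.intOrder (e₂Range d p s'.model))
      (fun e _ => (findBeta_spec ch hs' e).imp fun _ h => h.1)
    cases o with
    | none =>
      refine ⟨s', eventually_atTop_of_succ (ho1.mono fun n hn => ?_),
        fun P h => h.scale ch hs, hint, ?_,
        fun q hq h => pairGE_scale_of_ne ch hq hs h, Or.inl rfl⟩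
      · rw [localLoop]
        simp only [← hs'def, hn]
      · refine isMinimalAt_of_forall ch hd hs' fun e β hβ => ?_
        have he := mem_e₂Range ch hd hs' hint hβ
        rw [← (ch.intOrder_spec _).2] at he
        obtain ⟨o, h1, _, h3⟩ := findBeta_spec ch (p := p) hs' e
        -- Two eventual values of the same computation agree, as is seen at a common depth.
        obtain ⟨n, hn1, hn2⟩ := (h1.and (ho3 rfl e he)).exists
        rw [hn1] at hn2
        exact h3 (by simpa using hn2) β hβ
    | some c =>
      obtain ⟨e, he, hev⟩ := ho2 c rfl
      obtain ⟨o, h1, h2, _⟩ := findBeta_spec ch (p := p) hs' e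
      obtain ⟨n, hn1, hn2⟩ := (h1.and hev).exists
      rw [hn1, Option.some.injEq] at hn2
      obtain ⟨hce, hβq, hβ⟩ := h2 c hn2
      rw [← hce] at hβ
      have hlt := ordInt_modelRes_scale_move_lt ch hd hs' hβ
      have hmove : IsModel d (s'.move (ch.gen p) c.1 c.2).model := by
        rw [move_model ch hs']
        exact hs'.actModel one_ne_zero (by rw [det_affine]; exact ch.gen_zpow_ne_zero p _)
      obtain ⟨t, ht1, ht2, ht3, ht4, ht5, ht6⟩ := ih (s'.move (ch.gen p) c.1 c.2) hmove
        (by push_cast at hN; omega)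
      refine ⟨t, eventually_atTop_of_succ ((ho1.and ht1).mono fun n hn => ?_),
        fun P h => ht2 P ((h.scale ch hs).move ch hs' _ _), ht3, ht4,
        fun q hq h => ht5 q hq (pairGE_move_of_ne ch hq hs' (pairGE_scale_of_ne ch hq hs h) _
          (hβq q hq)), Or.inr ?_⟩
      · rw [localLoop]
        simp only [← hs'def, hn.1]
        exact hn.2
      · rcases ht6 with rfl | h
        · exact hlt
        · exact h.trans hlt

end LocalLoop

/-! ### From local to global minimality -/

section Global

variable {R : Type*} [CommRing R] [IsDedekindDomain R]
variable {K : Type*} [Field K] [Algebra R K] [IsFractionRing R K]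
variable {d : ℕ} {P : K[X] × K[X]}

open Filter

/-- The state holds a model over `R`, obtained from `P` by the recorded transformation. -/
structure GlobalState.IsTransformOf (R : Type*) [CommRing R] [IsDedekindDomain R] [Algebra R K]
    [IsFractionRing R K] (d : ℕ) (P : K[X] × K[X]) (s : GlobalState K) : Prop where
  l_ne_zero : s.l ≠ 0
  α_ne_zero : s.α ≠ 0
  model_eq : s.model = actModel d s.l !![s.α, s.β; 0, 1] P
  integral : ∀ q : HeightOneSpectrum R, PairGE q 0 s.model

lemma GlobalState.IsTransformOf.sameClass {s : GlobalState K} (h : s.IsTransformOf R d P) :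
    SameClass d P s.model :=
  sameClass_iff.2 ⟨_, _, h.l_ne_zero, by rw [det_affine]; exact h.α_ne_zero, h.model_eq⟩

/-- Minimality depends only on the class and the valuation of the resultant, so it survives later
steps, which never raise that valuation. -/
lemma IsMinimalAt.of_le {p : HeightOneSpectrum R} {Q S : K[X] × K[X]} (hP : IsModel d P)
    (hQ : SameClass d P Q) (hS : SameClass d P S) (h : IsMinimalAt p d Q)
    (hle : ordInt p (modelRes d S) ≤ ordInt p (modelRes d Q)) : IsMinimalAt p d S :=
  fun T hT hT0 => hle.trans (h T ((hQ.symm hP).trans (hS.trans hT)) hT0)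

variable (ch : Choices R K)

theorem globalStep_spec (hd : 2 ≤ d) (hP : IsModel d P) {s : GlobalState K}
    (hs : s.IsTransformOf R d P) (p : HeightOneSpectrum R) :
    ∃ t : GlobalState K, (∀ᶠ n in atTop, globalStep ch n d s p = some t) ∧
      t.IsTransformOf R d P ∧ IsMinimalAt p d t.model ∧
      (∀ q : HeightOneSpectrum R,
        ordInt q (modelRes d t.model) ≤ ordInt q (modelRes d s.model)) ∧
      (ordInt p (modelRes d t.model) = ordInt p (modelRes d s.model) → t = s) := by
  have hsm : IsModel d s.model := hs.sameClass.isModel hP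
  set s₀ : LocalState K := ⟨0, 0, 0, s.model⟩ with hs₀
  have hs₀m : IsModel d s₀.model := hsm
  obtain ⟨N, hN⟩ := exists_nat_gt (ordInt p (modelRes d (s₀.scale p (ch.gen p)).model))
  obtain ⟨t, ht1, ht2, ht3, ht4, ht5, ht6⟩ := localLoop_spec ch hd N s₀ hs₀m hN
  have hT : t.model = actModel d (algebraMap R K (ch.gen p) ^ t.e₁)
      !![algebraMap R K (ch.gen p) ^ t.e₂, t.β; 0, 1] s.model := by
    refine ht2 s.model ?_
    rw [LocalState.IsTransformOf, hs₀, zpow_zero, ← Matrix.one_fin_two,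
      actModel_scalar _ hsm.1 hsm.2.1]
    simp
  have h1 := ch.gen_zpow_ne_zero p t.e₁
  have h2 := ch.gen_zpow_ne_zero p t.e₂
  have hscale := ordInt_modelRes_scale ch (p := p) hs₀m
  have hk : 0 ≤ pairOrd p s₀.model :=
    (pairGE_iff_le (hs₀m.ne_zero hd)).1 (hs.integral p)
  have hdk : 0 ≤ 2 * (d : ℤ) * pairOrd p s₀.model := by positivity
  refine ⟨⟨s.l * algebraMap R K (ch.gen p) ^ t.e₁, s.α * algebraMap R K (ch.gen p) ^ t.e₂,
    s.β + s.α * t.β, t.model⟩, ht1.mono fun n hn => ?_,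
    ⟨mul_ne_zero hs.l_ne_zero h1, mul_ne_zero hs.α_ne_zero h2, ?_, fun q => ?_⟩, ht4,
    fun q => ?_, fun heq => ?_⟩
  · rw [globalStep, localMinimalModel, hn, Option.map_some]
  · dsimp only
    rw [hT, hs.model_eq, actModel_actModel, affine_mul_affine, mul_comm s.l]
  · by_cases hq : q = p
    · rw [hq]; exact ht3
    · exact ht5 q hq (hs.integral q)
  · by_cases hq : q = p
    · rw [hq]
      dsimp only
      change _ ≤ ordInt p (modelRes d s₀.model)
      rcases ht6 with h | h
      · rw [h]; omega
      · omega
    · dsimp only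
      rw [hT, ordInt_modelRes_actModel hsm h1 (by rwa [det_affine]), det_affine,
        ordInt_gen_zpow_of_ne ch hq, ordInt_gen_zpow_of_ne ch hq]
      simp
  · change ordInt p (modelRes d t.model) = ordInt p (modelRes d s₀.model) at heq
    -- The incoming model is integral, so scaling can only lower the valuation of the resultant, by
    -- 2d times the content. An unchanged valuation excludes both moves and nontrivial scaling.
    have hk0 : pairOrd p s₀.model = 0 := by
      have h3 : 2 * (d : ℤ) * pairOrd p s₀.model = 0 := by
        rcases ht6 with h | h
        · rw [h] at heq; omega
        · omega
      rcases mul_eq_zero.1 h3 with h4 | h4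
      · omega
      · exact h4
    have hts : t = s₀ := by
      rw [scale_eq_self ch hk0] at ht6
      rcases ht6 with h | h
      · exact h
      · omega
    rw [hts]
    simp [hs₀]

theorem foldlM_globalStep_spec (hd : 2 ≤ d) (hP : IsModel d P)
    (L : List (HeightOneSpectrum R)) {s : GlobalState K} (hs : s.IsTransformOf R d P) :
    ∃ t : GlobalState K, (∀ᶠ n in atTop, L.foldlM (globalStep ch n d) s = some t) ∧
      t.IsTransformOf R d P ∧ (∀ p ∈ L, IsMinimalAt p d t.model) ∧
      (∀ q : HeightOneSpectrum R,
        ordInt q (modelRes d t.model) ≤ ordInt q (modelRes d s.model)) ∧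
      ((∀ q : HeightOneSpectrum R,
        ordInt q (modelRes d s.model) ≤ ordInt q (modelRes d t.model)) → t = s) := by
  induction L generalizing s with
  | nil => exact ⟨s, by simp, hs, by simp, fun q => le_rfl, fun _ => rfl⟩
  | cons p L ih =>
    obtain ⟨u, hu1, hu2, hu3, hu4, hu5⟩ := globalStep_spec ch hd hP hs p
    obtain ⟨t, ht1, ht2, ht3, ht4, ht5⟩ := ih hu2
    refine ⟨t, (hu1.and ht1).mono fun n hn => ?_, ht2, fun q hq => ?_,
      fun q => (ht4 q).trans (hu4 q), fun h => ?_⟩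
    · rw [List.foldlM_cons, hn.1]
      exact hn.2
    · rcases List.mem_cons.1 hq with rfl | hq
      · exact hu3.of_le hP hu2.sameClass ht2.sameClass (ht4 q)
      · exact ht3 q hq
    · rw [ht5 fun q => (hu4 q).trans (h q)]
      exact hu5 (le_antisymm (hu4 p) ((h p).trans (ht4 p)))

lemma ordGE_algebraMap_iff_le_emultiplicity {p : HeightOneSpectrum R} {r : R} {n : ℕ} :
    OrdGE p n (algebraMap R K r) ↔ (n : ℕ∞) ≤ emultiplicity p.asIdeal (Ideal.span {r}) := by
  rw [OrdGE, HeightOneSpectrum.valuation_of_algebraMap,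
    HeightOneSpectrum.intValuation_le_exp_iff_le_emultiplicity]

lemma mem_candidatePrimes (hd : 2 ≤ d) {r : R} (hr : r ≠ 0) {p : HeightOneSpectrum R} :
    p ∈ candidatePrimes d r ↔ OrdGE p (d * Nat.gcd 2 (d + 1) : ℕ) (algebraMap R K r) := by
  have hpos : 0 < d * Nat.gcd 2 (d + 1) :=
    Nat.mul_pos (by omega) (Nat.gcd_pos_of_pos_left _ (by norm_num))
  have hfin : {p : HeightOneSpectrum R |
      ((d * Nat.gcd 2 (d + 1) : ℕ) : ℕ∞) ≤ emultiplicity p.asIdeal (Ideal.span {r})}.Finite := by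
    refine (Ideal.finite_factors (I := Ideal.span {r}) (by simpa using hr)).subset fun p hp => ?_
    have := pow_dvd_of_le_emultiplicity hp
    exact (dvd_pow_self _ hpos.ne').trans this
  rw [candidatePrimes, dif_pos hfin, Set.Finite.mem_toFinset, Set.mem_ofPred_eq,
    ordGE_algebraMap_iff_le_emultiplicity]

/-- The resultant changes by a multiple of `d * gcd (2, d + 1)`, so that a model with a resultant
of smaller valuation is minimal. -/
lemma isMinimalAt_of_ordInt_lt {p : HeightOneSpectrum R} (hP : IsModel d P)
    (hlt : ordInt p (modelRes d P) < (d * Nat.gcd 2 (d + 1) : ℕ)) : IsMinimalAt p d P := by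
  intro Q hPQ hQ
  have hQ0 := hQ.ordInt_modelRes_nonneg (d := d)
  obtain ⟨l, A, hl, hA, rfl⟩ := sameClass_iff.1 hPQ
  have hord := ordInt_modelRes_actModel (p := p) hP hl hA
  by_contra hcon
  have hdvd : ((d * Nat.gcd 2 (d + 1) : ℕ) : ℤ) ∣
      ordInt p (modelRes d P) - ordInt p (modelRes d (actModel d l A P)) := by
    rw [hord]
    obtain ⟨u, hu⟩ := Nat.gcd_dvd_left 2 (d + 1)
    obtain ⟨w, hw⟩ := Nat.gcd_dvd_right 2 (d + 1)
    have hu' : (2 : ℤ) = (Nat.gcd 2 (d + 1) : ℕ) * (u : ℤ) := by exact_mod_cast hu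
    have hw' : (d + 1 : ℤ) = (Nat.gcd 2 (d + 1) : ℕ) * (w : ℤ) := by exact_mod_cast hw
    refine ⟨-(u * ordInt p l + w * ordInt p A.det), ?_⟩
    push_cast
    linear_combination (-(d : ℤ) * ordInt p l) * hu' - (d : ℤ) * ordInt p A.det * hw'
  have := Int.le_of_dvd (by omega) hdvd
  omega

lemma exists_algebraMap_eq {x : K} (h : ∀ q : HeightOneSpectrum R, OrdGE q 0 x) :
    ∃ r : R, algebraMap R K r = x :=
  HeightOneSpectrum.mem_integers_of_valuation_le_one (R := R) K x fun q => by
    simpa [OrdGE] using h q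

/-- For every integral model S of the class, Res(S)/Res(Q) is integral at every prime, hence in R;
so Res(Q) divides all the generators of the ideal. -/
lemma isMinimalModelOf_of_isMinimalAt {Q : K[X] × K[X]} (hP : IsModel d P) (hPQ : SameClass d P Q)
    (hint : ∀ q : HeightOneSpectrum R, PairGE q 0 Q)
    (hmin : ∀ q : HeightOneSpectrum R, IsMinimalAt q d Q) : IsMinimalModelOf R d P Q := by
  have hQ := hPQ.isModel hP
  obtain ⟨r, hr⟩ := exists_algebraMap_eq fun q => (hint q).ordGE_modelRes (d := d)
  refine ⟨hQ, isOver_iff_pairGE.2 hint, hPQ, r, hr, le_antisymm ?_ ?_⟩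
  · rw [resIdeal, Ideal.span_le]
    rintro r' ⟨S, hS, hSR, hPS, hr'⟩
    rw [SetLike.mem_coe, Ideal.mem_span_singleton]
    obtain ⟨c, hc⟩ := exists_algebraMap_eq (R := R) (x := modelRes d S * (modelRes d Q)⁻¹) fun q => by
      have h1 := hmin q S ((hPQ.symm hP).trans hPS) (isOver_iff_pairGE.1 hSR q)
      have h2 := inv_ne_zero hQ.2.2
      rw [ordGE_iff (mul_ne_zero hS.2.2 h2), ordInt_mul hS.2.2 h2, ordInt_inv hQ.2.2]
      omega
    refine ⟨c, IsFractionRing.injective R K ?_⟩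
    rw [map_mul, hr', hr, hc, mul_comm, inv_mul_cancel_right₀ hQ.2.2]
  · rw [Ideal.span_singleton_le_iff_mem]
    exact Ideal.subset_span ⟨Q, hQ, isOver_iff_pairGE.2 hint, hPQ, hr⟩

/-- A generator of the ideal divides the resultant of every integral model. This is the link from
minimal input to the absence of any drop. -/
lemma IsMinimalModelOf.ordInt_le {S : K[X] × K[X]} (h : IsMinimalModelOf R d P P)
    (hS : IsModel d S) (hPS : SameClass d P S) (hint : ∀ q : HeightOneSpectrum R, PairGE q 0 S)
    (q : HeightOneSpectrum R) : ordInt q (modelRes d P) ≤ ordInt q (modelRes d S) := by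
  obtain ⟨hP, _, _, r, hr, hspan⟩ := h
  obtain ⟨r', hr'⟩ := exists_algebraMap_eq fun q => (hint q).ordGE_modelRes (d := d)
  have hmem : r' ∈ resIdeal R d P :=
    Ideal.subset_span ⟨S, hS, isOver_iff_pairGE.2 hint, hPS, hr'⟩
  rw [hspan, Ideal.mem_span_singleton] at hmem
  obtain ⟨c, rfl⟩ := hmem
  rw [map_mul, hr] at hr'
  rw [← hr']
  have hc : algebraMap R K c ≠ 0 := by
    intro h0
    rw [h0, mul_zero] at hr'
    exact hS.2.2 hr'.symm
  rw [ordInt_mul hP.2.2 hc]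
  have := (ordGE_algebraMap (p := q) (K := K) c).ordInt_le hc
  omega

end Global

theorem mainTheorem12 {R : Type*} [CommRing R] [IsDomain R] [IsPrincipalIdealRing R]
    {K : Type*} [Field K] [Algebra R K] [IsFractionRing R K]
    (d : ℕ) (hd : 2 ≤ d) (f g : R[X]) (hdeg : max f.natDegree g.natDegree = d)
    (hmodel : IsModel d (f.map (algebraMap R K), g.map (algebraMap R K)))
    (ch : Choices R K) :
    ∃ (N : ℕ) (out : GlobalState K),
      (∀ n, N ≤ n → minimalModel ch n f g = some out) ∧
      out.l ≠ 0 ∧ out.α ≠ 0 ∧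
      out.model = actModel d out.l !![out.α, out.β; 0, 1]
        (f.map (algebraMap R K), g.map (algebraMap R K)) ∧
      IsMinimalModelOf R d (f.map (algebraMap R K), g.map (algebraMap R K)) out.model ∧
      (IsMinimalModelOf R d (f.map (algebraMap R K), g.map (algebraMap R K))
          (f.map (algebraMap R K), g.map (algebraMap R K)) →
        out = ⟨1, 1, 0, (f.map (algebraMap R K), g.map (algebraMap R K))⟩) := by
  set P : K[X] × K[X] := (f.map (algebraMap R K), g.map (algebraMap R K)) with hP
  have hres : modelRes d P = algebraMap R K (resultant f g d d) := by
    rw [modelRes, hP, resultant_map_map]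
  have hr0 : resultant f g d d ≠ 0 := by
    intro h
    apply hmodel.2.2
    rw [hres, h, map_zero]
  have hstart : (⟨1, 1, 0, P⟩ : GlobalState K).IsTransformOf R d P := by
    refine ⟨one_ne_zero, one_ne_zero, ?_, fun q => ⟨fun i => ?_, fun i => ?_⟩⟩
    · dsimp only
      rw [← Matrix.one_fin_two, actModel_scalar _ hmodel.1 hmodel.2.1]
      simp
    · dsimp only [hP]
      rw [coeff_map]; exact ordGE_algebraMap _
    · dsimp only [hP]
      rw [coeff_map]; exact ordGE_algebraMap _
  obtain ⟨out, h1, h2, h3, h4, h5⟩ := foldlM_globalStep_spec ch hd hmodel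
    (ch.primeOrder (candidatePrimes d (resultant f g d d))) hstart
  obtain ⟨N, hN⟩ := Filter.eventually_atTop.1 h1
  refine ⟨N, out, fun n hn => ?_, h2.l_ne_zero, h2.α_ne_zero, h2.model_eq, ?_, fun hmin => ?_⟩
  · rw [minimalModel]
    simp only [hdeg]
    exact hN n hn
  · refine isMinimalModelOf_of_isMinimalAt hmodel h2.sameClass h2.integral fun q => ?_
    by_cases hq : q ∈ candidatePrimes d (resultant f g d d)
    · exact h3 q (((ch.primeOrder_spec _).2 q).2 hq)
    -- At a prime not visited the input is already minimal, its resultant being too small to drop,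
    -- and the steps at the other primes do not raise its valuation there.
    · have hself : SameClass d P P := hstart.sameClass
      refine IsMinimalAt.of_le hmodel hself h2.sameClass (isMinimalAt_of_ordInt_lt hmodel ?_) (h4 q)
      rw [mem_candidatePrimes (K := K) hd hr0, ← hres, ordGE_iff hmodel.2.2, not_le] at hq
      exact hq
  · exact h5 fun q => hmin.ordInt_le (h2.sameClass.isModel hmodel) h2.sameClass h2.integral q
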